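/- Throughout, $I_s=\{1,\dots,s\}$ for $s\in\mathbb N=\{1,2,\dots\}$, and $\gamma=(\gamma_{s,u})_{s\in\mathbb N,\,u\subseteq I_s}$ are arbitrary non-negative real weights. **Discrepancy.** For points $x_0,\dots,x_{N-1}\in[0,1)^s$ put $\Delta(t)=\frac1N\#\{n: x_n\in[0,t_1)\times\dots\times[0,t_s)\}-t_1\cdots t_s$ (with first term $0$ if $N=0$), and $$\mathcal L_{2,N,\gamma}^2=\sum_{\emptyset\ne u\subseteq I_s}\gamma_{s,u}\int_{[0,1]^u}|\Delta(t_u,1)|^2\,dt_u ,$$ where $(t_u,1)$ has the components outside $u$ replaced by $1$. Scrambling a point set means Owen's scrambling: the dyadic digits $x_{j,1},x_{j,2},\dots$ of the $j$-th coordinate of every point are replaced by $y_{j,k}=\pi_{j,x_{j,1},\dots,x_{j,k-1}}(x_{j,k})$, where the $\pi_{j,a_1,\dots,a_{k-1}}$ are independent uniformly distributed random permutations of $\{0,1\}$. The mean square weighted $\mathcal L_2$ discrepancy is the expectation $\mathbb E[\mathcal L_{2,N,\gamma}^2]$ of the scrambled point set; for the empty point set $(N=0)$ it is denoted $\mathbb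 E[\mathcal L^2_{2,0,\gamma}]$. **Polynomial lattice rules.** Let $p\in\mathbb F_2[x]$ be irreducible with $\deg p=m\ge1$ and $q=(q_1,\dots,q_s)\in\mathbb F_2[x]^s$. The polynomial lattice point set $P_{2^m,s}(q,p)$ consists of the points $x_n=\bigl(v_m(n(x)q_j(x)/p(x))\bigr)_{j=1}^s$, $0\le n<2^m$, where $n(x)=\sum_i n_ix^i$ for $n=\sum_i n_i2^i$ in binary, and $v_m$ maps a Laurent series $\sum_{l\ge w} t_lx^{-l}\in\mathbb F_2((x^{-1}))$ to $\sum_{l=\max(1,w)}^m t_l2^{-l}$. **CBC construction.** Given $m$ and $s$, choose an irreducible $p$ with $\deg p=m$, set $q_1=1$, and for $\tau=2,\dots,s$ choose $q_\tau$ as a minimizer, over the non-zero polynomials of degree less than $m$ and with $q_1,\dots,q_{\tau-1}$ fixed, of $$B((q_1,\dots,q_\tau),\gamma)=\sum_{\emptyset\ne v\subseteq I_\tau}\Bigl(\sum_{v\subseteq u\subseteq I_s}\frac{\gamma_{s,u}}{3^{|u|}}\Bigr)\sum_{k}\ \prod_{j\in v}\psi(k_j),$$ where the inner sum is over all $k=(k_j)_{j\in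 v}\in\mathbb N^{v}$ with $\sum_{j\in v}\mathrm{tr}_m(k_j)\,q_j\equiv0\pmod p$; here $\mathrm{tr}_m(k)=\sum_{i<m}\kappa_ix^i$ for $k=\sum_i\kappa_i2^i$ in binary, and $\psi(k)=4^{-a}$ for $2^{a-1}\le k<2^a$. **Tractability.** Fix, for every $s,m\in\mathbb N$, an output $(p,q)$ of the CBC construction, and let $$N(s,\epsilon)=\min\{N=2^m:\ m\in\mathbb N,\ \mathbb E[\mathcal L_{2,N,\gamma}^2(\tilde P_{N,s})]\le\epsilon\,\mathbb E[\mathcal L^2_{2,0,\gamma}]\},$$ where $\tilde P_{2^m,s}$ is the scrambled $P_{2^m,s}(q,p)$. The discrepancy is strongly tractable with exponent $\beta\ge0$ if there is a constant $C\ge 0$, independent of $s$, $\epsilon$ and of the choices made in the constructions, such that $N(s,\epsilon)$ exists and $N(s,\epsilon)\le C\epsilon^{-\beta}$ for all $s\in\mathbb N$ and all $\epsilon\in(0,1)$. **Corollary.** Let $1/2<\lambda\le1$ and suppose that $$B_{\gamma,\lambda}:=\sup_{s\in\mathbb N}\frac{\Bigl[\sum_{\emptyset\ne u\subseteq I_s}\bigl(\frac{\gamma_{s,u}}{3^{|u|}}\bigr)^{\lambda}\Bigl(-1+\bigl(\frac{2^{2\lambda}-1}{2^{2\lambda}-2}\bigr)^{|u|}\Bigr)\Bigr]^{1/\lambda}}{\sum_{\emptyset\ne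 u\subseteq I_s}\frac{\gamma_{s,u}}{3^{|u|}}}<\infty$$ (a ratio $0/0$, which occurs only if $\gamma_{s,u}=0$ for all $\emptyset\ne u\subseteq I_s$, counts as $0$). Then the mean square weighted $\mathcal L_2$ discrepancy of the CBC-constructed scrambled polynomial lattice rules is strongly tractable with exponent $\lambda$; that is, its exponent of tractability is at most $\lambda$. -/

import Mathlib

open scoped ENNReal

noncomputable section

namespace PolyLattice

/-! ### The weighted `L₂` discrepancy -/

/-- Local discrepancy function `Δ(t) = A_N([0,t), P) / N - t₁ ⋯ tₛ` of the points
`x₀, …, x_{N-1}`. For the empty point set (`N = 0`) the first term is `0 / 0 = 0`, i.e.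
`Δ(t) = - t₁ ⋯ tₛ`, which is the usual convention for the initial discrepancy. -/
def localDiscrepancy {N s : ℕ} (x : Fin N → Fin s → ℝ) (t : Fin s → ℝ) : ℝ :=
  (Nat.card {n : Fin N // ∀ j, x n j ∈ Set.Ico 0 (t j)} : ℝ) / N - ∏ j, t j

/-- The vector `(t_u, 1)`: the components outside `u` are replaced by one. -/
def extendByOne {s : ℕ} (u : Finset (Fin s)) (t : u → ℝ) : Fin s → ℝ :=
  fun j => if h : j ∈ u then t ⟨j, h⟩ else 1

/-- The weighted `L₂` discrepancy with weights `γ_u`, `u ⊆ I_s`. -/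
def weightedL2 {N s : ℕ} (γ : Finset (Fin s) → ℝ) (x : Fin N → Fin s → ℝ) : ℝ :=
  Real.sqrt (∑ u : Finset (Fin s) with u.Nonempty,
    γ u * ∫ t in Set.Icc (0 : u → ℝ) 1, |localDiscrepancy x (extendByOne u t)| ^ 2)

/-! ### Polynomial lattice point sets -/

/-- `tr_m(k) = κ₀ + κ₁ x + ⋯ + κ_{m-1} x^{m-1}`, where the `κᵢ` are the binary digits of `k`. -/
def truncPoly (m k : ℕ) : Polynomial (ZMod 2) :=
  ∑ i ∈ Finset.range m, if k.testBit i then Polynomial.X ^ i else 0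

/-- The polynomial `k(x)` associated with the binary expansion of `k`. -/
def natPoly (k : ℕ) : Polynomial (ZMod 2) :=
  truncPoly k.size k

/-- The embedding of `𝔽₂[x]` into the field `𝔽₂((x⁻¹))`. The latter is realised as the field of
Laurent series in the variable `x⁻¹`, so that the coefficient of index `l` is that of `x^{-l}`
and `x` itself is the monomial of index `-1`. -/
def toLaurent (f : Polynomial (ZMod 2)) : LaurentSeries (ZMod 2) :=
  Polynomial.aeval (HahnSeries.single (-1 : ℤ) (1 : ZMod 2) : LaurentSeries (ZMod 2)) f

/-- `v_m (∑_l t_l x^{-l}) = ∑_{1 ≤ l ≤ m} t_l 2^{-l}`. -/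
def vMap (m : ℕ) (L : LaurentSeries (ZMod 2)) : ℝ :=
  ∑ l ∈ Finset.Icc 1 m, ((L.coeff (l : ℤ)).val : ℝ) / 2 ^ l

/-- The polynomial lattice point set `P_{2^m,s}(q, p)`. -/
def latticePoint {s : ℕ} (m : ℕ) (p : Polynomial (ZMod 2)) (q : Fin s → Polynomial (ZMod 2)) :
    Fin (2 ^ m) → Fin s → ℝ :=
  fun n j => vMap m (toLaurent (natPoly n) * toLaurent (q j) / toLaurent p)

/-! ### Owen's scrambling -/

/-- Every set of permutations of `{0, 1}` is measurable. -/
instance instMeasurableSpacePerm : MeasurableSpace (Equiv.Perm (Fin 2)) := ⊤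

/-- A scramble: a permutation `π_{j,a₁,…,a_{k-1}}` of `{0, 1}` for each coordinate `j` and each
finite sequence `a₁, …, a_{k-1}` of preceding digits. -/
abbrev Scramble (s : ℕ) : Type := Fin s × List (Fin 2) → Equiv.Perm (Fin 2)

/-- The law of the random scramble: all permutations are independent and uniform. -/
def scrambleLaw (s : ℕ) : MeasureTheory.Measure (Scramble s) :=
  MeasureTheory.Measure.infinitePi
    (fun _ => (PMF.uniformOfFintype (Equiv.Perm (Fin 2))).toMeasure)

/-- The scrambled point `y` of `x ∈ [0,1)^s`:
`y_{j,k} = π_{j,x_{j,1},…,x_{j,k-1}}(x_{j,k})`, where `x_{j,1}, x_{j,2}, …` are the dyadic digits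
of `x_j`. Here `Real.digits (x j) 2 k` is the digit `x_{j,k+1}`. -/
def scramblePoint {s : ℕ} (π : Scramble s) (x : Fin s → ℝ) : Fin s → ℝ :=
  fun j => Real.ofDigits fun k : ℕ =>
    π (j, List.ofFn fun i : Fin k => Real.digits (x j) 2 i) (Real.digits (x j) 2 k)

/-- The mean square weighted `L₂` discrepancy of the scrambled point set: all points of the
set are scrambled with the same random scramble. -/
def meanSquareL2 {N s : ℕ} (γ : Finset (Fin s) → ℝ) (x : Fin N → Fin s → ℝ) : ℝ :=
  ∫ π, weightedL2 γ (fun n => scramblePoint π (x n)) ^ 2 ∂(scrambleLaw s)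

/-- The mean square weighted `L₂` discrepancy of the empty point set. -/
def initialMeanSquareL2 {s : ℕ} (γ : Finset (Fin s) → ℝ) : ℝ :=
  meanSquareL2 γ (fun n : Fin 0 => n.elim0)

/-! ### The component-by-component construction -/

/-- The dual polynomial lattice `{k ∈ ℕ₀^s : tr_m(k) · q ≡ 0 (mod p)}`. -/
def dualLattice {s : ℕ} (m : ℕ) (p : Polynomial (ZMod 2)) (q : Fin s → Polynomial (ZMod 2)) :
    Set (Fin s → ℕ) :=
  {k | p ∣ ∑ j, truncPoly m (k j) * q j}

/-- `ψ(0) = 1` and `ψ(k) = 4^{-a}` for `2^{a-1} ≤ k < 2^a`. -/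
def psi (k : ℕ) : ℝ := 1 / 4 ^ k.size

/-- `γ̃_v = ∑_{v ⊆ u ⊆ I_s} γ_u / 3^{|u|}`. -/
def gammaTilde {s : ℕ} (γ : Finset (Fin s) → ℝ) (v : Finset (Fin s)) : ℝ :=
  ∑ u : Finset (Fin s) with v ⊆ u, γ u / 3 ^ u.card

/-- The quantity `B((q₁, …, q_τ), γ)`, i.e. the sum over nonempty `v ⊆ {1, …, τ}` of `γ̃_v` times
the sum of `ψ(k)` over all `k` in the dual lattice whose set of nonzero components is `v`, that
is, over all vectors `(k_v, 0)` in the dual lattice with `k_v` having positive components.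
Only the first `τ` components of `q` enter. -/
def criterion {s : ℕ} (γ : Finset (Fin s) → ℝ) (m : ℕ) (p : Polynomial (ZMod 2)) (τ : ℕ)
    (q : Fin s → Polynomial (ZMod 2)) : ℝ :=
  ∑ v : Finset (Fin s) with v.Nonempty ∧ ∀ j ∈ v, j.val < τ,
    gammaTilde γ v *
      ∑' k : {k : Fin s → ℕ // k ∈ dualLattice m p q ∧ ∀ j, k j ≠ 0 ↔ j ∈ v},
        ∏ j, psi (k.1 j)

/-- `R_m`: the nonzero polynomials over `𝔽₂` of degree less than `m`. -/
def candidates (m : ℕ) : Set (Polynomial (ZMod 2)) :=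
  {r | r ≠ 0 ∧ r.degree < m}

/-- `(p, q)` is a possible output of the component-by-component construction with general
weights `γ`: `p` is irreducible of degree `m`, `q₁ = 1`, and for `τ = 2, …, s` the component
`q_τ ∈ R_m` minimises `B((q₁, …, q_{τ-1}, q_τ), γ)` over `R_m`. (The coordinate `τ` has index
`j = τ - 1` in `Fin s`.) -/
structure IsCBC {s : ℕ} (γ : Finset (Fin s) → ℝ) (m : ℕ) (p : Polynomial (ZMod 2))
    (q : Fin s → Polynomial (ZMod 2)) : Prop where
  irreducible : Irreducible p
  natDegree_eq : p.natDegree = m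
  first : ∀ j : Fin s, j.val = 0 → q j = 1
  mem : ∀ j : Fin s, q j ∈ candidates m
  minimal : ∀ j : Fin s, 0 < j.val → ∀ r ∈ candidates m,
    criterion γ m p (j.val + 1) q ≤ criterion γ m p (j.val + 1) (Function.update q j r)

/-! ### Tractability -/

/-- The set of all `N = 2^m`, `m ≥ 1`, for which the scrambled polynomial lattice point set given
by the `m`-th pair `(p, q)` reduces the initial mean square discrepancy by the factor `ε`. The
inverse `N(s, ε)` is the minimum of this set. -/
def goodSizes {s : ℕ} (γ : Finset (Fin s) → ℝ) (p : ℕ → Polynomial (ZMod 2))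
    (q : ℕ → Fin s → Polynomial (ZMod 2)) (ε : ℝ) : Set ℕ :=
  {N | ∃ m : ℕ, 1 ≤ m ∧ N = 2 ^ m ∧
    meanSquareL2 γ (latticePoint m (p m) (q m)) ≤ ε * initialMeanSquareL2 γ}

/-- The mean square weighted `L₂` discrepancy of the CBC-constructed scrambled polynomial lattice
rules is strongly tractable with exponent `β`: there is a constant `C` such that, whatever
irreducible polynomials are chosen and however ties are broken in the construction, the inverse
`N(s, ε)` exists and is at most `C ε^{-β}` for all `s ≥ 1` and `0 < ε < 1`. -/
def StronglyTractable (γ : (s : ℕ) → Finset (Fin s) → ℝ) (β : ℝ) : Prop :=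
  0 ≤ β ∧ ∃ C : ℝ, 0 ≤ C ∧
    ∀ (s : ℕ), 1 ≤ s →
    ∀ (p : ℕ → Polynomial (ZMod 2)) (q : ℕ → Fin s → Polynomial (ZMod 2)),
      (∀ m, 1 ≤ m → IsCBC (γ s) m (p m) (q m)) →
      ∀ ε : ℝ, 0 < ε → ε < 1 →
        ∃ N : ℕ, IsLeast (goodSizes (γ s) p q ε) N ∧ (N : ℝ) ≤ C * ε ^ (-β)

/-- The ratio whose supremum over `s` is `B_{γ,λ}`. -/
def weightRatio {s : ℕ} (γ : Finset (Fin s) → ℝ) (lam : ℝ) : ℝ :=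
  (∑ u : Finset (Fin s) with u.Nonempty,
      (γ u / 3 ^ u.card) ^ lam *
        (-1 + (((2 : ℝ) ^ (2 * lam) - 1) / ((2 : ℝ) ^ (2 * lam) - 2)) ^ u.card)) ^ (1 / lam) /
    ∑ u : Finset (Fin s) with u.Nonempty, γ u / 3 ^ u.card

/-- `B_{γ,λ}`, the supremum over all `s ≥ 1`, as an extended real number. -/
def weightConst (γ : (s : ℕ) → Finset (Fin s) → ℝ) (lam : ℝ) : EReal :=
  ⨆ (s : ℕ) (_ : 1 ≤ s), (weightRatio (γ s) lam : EReal)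

end PolyLattice

end

open MeasureTheory ProbabilityTheory

namespace PolyLattice

/-! The mean square discrepancy of a scrambled polynomial lattice is exactly the quantity that the
component-by-component search minimises, so an averaging argument over the candidates bounds it.

Exact formula. Warnock's formula (`setIntegral_localDiscrepancy_sq`) writes the squared discrepancy
over a face as sums of products of one-coordinate kernels, and the scrambles of different
coordinates are independent. The expectation of the kernel `1 - max y y'` depends only on the first
digit at which the unscrambled coordinates differ; it is one third of a Walsh series with
coefficients `psi` (`integral_max_treeReal_eq_walshSeries`). On a polynomial lattice the Walsh
functions become characters `chi (residue p _)`, and summing them over the points keeps precisely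
the dual lattice (`sum_chi_residue`). This yields `meanSquareL2_latticePoint`: the mean square
discrepancy equals `criterion` with all `s` components.

Averaging. The indices whose last nonzero component is `j` form the only part of the criterion that
the choice of `q j` affects (`ofReal_criterion_succ`). Raise that part to the power `lam`, move the
power inside the sum by subadditivity, and sum over all `2 ^ m - 1` candidates. For fixed other
components, a given `k j` either satisfies the dual condition for at most one candidate, or the
condition is just `2 ^ m ∣ k j`, where the decay of `psi` pays for the number of candidates
(`sum_tsum_psiPow_le`). Adding up the components gives `IsCBC.mul_criterion_rpow_le`, and the
remaining sum over all indices is at most the numerator sum of the weight ratio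
(`tsum_weight_rpow_le`).

Conclusion. The squared error is therefore at most a constant times `2 ^ (-m / lam)` relative to the
initial one, uniformly in `s`; solving for `2 ^ m` gives the exponent `lam`. -/

instance : DiscreteMeasurableSpace (Equiv.Perm (Fin 2)) := ⟨fun _ => trivial⟩

/-! ### Scrambling a single coordinate -/

/-- The uniform distribution on the permutations of `{0, 1}`. -/
noncomputable def permLaw : Measure (Equiv.Perm (Fin 2)) :=
  (PMF.uniformOfFintype (Equiv.Perm (Fin 2))).toMeasure

instance : IsProbabilityMeasure permLaw := by unfold permLaw; infer_instance

/-- A scramble of a single coordinate. -/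
abbrev TreeScramble : Type := List (Fin 2) → Equiv.Perm (Fin 2)

/-- The law of the random scramble of a single coordinate. -/
noncomputable def treeLaw : Measure TreeScramble := Measure.infinitePi fun _ => permLaw

instance : IsProbabilityMeasure treeLaw := by unfold treeLaw; infer_instance

/-- The list of the first `k` digits. -/
def digitPrefix (d : ℕ → Fin 2) (k : ℕ) : List (Fin 2) := List.ofFn fun i : Fin k => d i

/-- The scrambled value of a digit sequence. -/
noncomputable def treeReal (d : ℕ → Fin 2) (π : TreeScramble) : ℝ :=
  Real.ofDigits fun k => π (digitPrefix d k) (d k)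

/-- The digits `0, 1` turned into the signs `-1, 1`. -/
noncomputable def digitSign (a : Fin 2) : ℝ := if a = 0 then -1 else 1

/-- The sign of a permutation of `{0, 1}`. -/
noncomputable def permSign (σ : Equiv.Perm (Fin 2)) : ℝ := digitSign (σ 1)

lemma digitSign_mul_self (a : Fin 2) : digitSign a * digitSign a = 1 := by
  unfold digitSign; split_ifs <;> norm_num

lemma abs_digitSign (a : Fin 2) : |digitSign a| = 1 := by
  unfold digitSign; split_ifs <;> norm_num

lemma abs_permSign (σ : Equiv.Perm (Fin 2)) : |permSign σ| = 1 := abs_digitSign _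

lemma permSign_mul_self (σ : Equiv.Perm (Fin 2)) : permSign σ * permSign σ = 1 :=
  digitSign_mul_self _

lemma digitSign_apply (σ : Equiv.Perm (Fin 2)) (a : Fin 2) :
    digitSign (σ a) = digitSign a * permSign σ := by
  have h : ∀ (σ : Equiv.Perm (Fin 2)) (a : Fin 2),
      (σ a = 0 ↔ (a = 0 ↔ ¬ σ 1 = 0)) := by decide
  unfold permSign digitSign
  have := h σ a
  by_cases h1 : a = 0 <;> by_cases h2 : σ 1 = 0 <;> simp_all

lemma cast_eq_digitSign (a : Fin 2) : ((a : ℕ) : ℝ) = (1 + digitSign a) / 2 := by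
  fin_cases a <;> simp [digitSign]

lemma digitSign_of_ne {a b : Fin 2} (h : a ≠ b) : digitSign b = -digitSign a := by
  fin_cases a <;> fin_cases b <;> simp_all [digitSign]

lemma digitPrefix_injective (d : ℕ → Fin 2) : Function.Injective (digitPrefix d) := by
  intro k l h
  simpa [digitPrefix] using congrArg List.length h

lemma digitPrefix_congr {d d' : ℕ → Fin 2} {k : ℕ} (h : ∀ i < k, d i = d' i) :
    digitPrefix d k = digitPrefix d' k := by
  unfold digitPrefix
  congr 1
  funext i
  exact h i i.2

lemma integral_permSign : ∫ σ, permSign σ ∂permLaw = 0 := by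
  unfold permLaw
  rw [PMF.integral_eq_sum]
  simp only [PMF.uniformOfFintype_apply, smul_eq_mul]
  rw [← Finset.mul_sum]
  have : (Finset.univ : Finset (Equiv.Perm (Fin 2))) = {1, Equiv.swap 0 1} := by decide
  rw [this, Finset.sum_pair (by decide)]
  simp [permSign, digitSign]

lemma measurable_permSign_apply (l : List (Fin 2)) :
    Measurable fun π : TreeScramble => permSign (π l) :=
  (measurable_from_top (f := permSign)).comp (measurable_pi_apply l)

lemma integral_permSign_apply (l : List (Fin 2)) : ∫ π, permSign (π l) ∂treeLaw = 0 := by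
  have h := measurePreserving_eval_infinitePi (fun _ : List (Fin 2) => permLaw) l
  rw [← integral_permSign, ← h.map_eq,
    integral_map h.measurable.aemeasurable (Measurable.of_discrete).aestronglyMeasurable]
  rfl

/-- Signs at distinct nodes are independent and centred, hence orthonormal. The second moments of
scrambled values below all come from this. -/
lemma integral_permSign_mul (l l' : List (Fin 2)) :
    ∫ π, permSign (π l) * permSign (π l') ∂treeLaw = if l = l' then 1 else 0 := by
  split_ifs with h
  · subst h
    simp [permSign_mul_self]
  · have hi := (iIndepFun_infinitePi (P := fun _ : List (Fin 2) => permLaw)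
      (X := fun _ σ => permSign σ) fun _ => measurable_from_top).indepFun h
    have := hi.integral_mul_eq_mul_integral
      (measurable_permSign_apply l).aestronglyMeasurable
      (measurable_permSign_apply l').aestronglyMeasurable
    simp only [Pi.mul_apply] at this
    have h0 := integral_permSign_apply l
    unfold treeLaw at h0 ⊢
    rw [this, h0, zero_mul]

/-- The centred and rescaled scrambled value. -/
noncomputable def treeSum (d : ℕ → Fin 2) (π : TreeScramble) : ℝ :=
  ∑' k : ℕ, (1 / 2 : ℝ) ^ (k + 1) * digitSign (d k) * permSign (π (digitPrefix d k))

lemma summable_half_pow : Summable fun k : ℕ => (1 / 2 : ℝ) ^ (k + 1) :=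
  (summable_nat_add_iff 1).2 (summable_geometric_of_lt_one (by norm_num) (by norm_num))

lemma tsum_half_pow : ∑' k : ℕ, (1 / 2 : ℝ) ^ (k + 1) = 1 := by
  simp_rw [pow_succ]
  rw [tsum_mul_right, tsum_geometric_of_lt_one (by norm_num) (by norm_num)]
  norm_num

lemma summable_treeSum (d : ℕ → Fin 2) (π : TreeScramble) :
    Summable fun k : ℕ =>
      (1 / 2 : ℝ) ^ (k + 1) * digitSign (d k) * permSign (π (digitPrefix d k)) := by
  refine Summable.of_norm_bounded summable_half_pow fun k => ?_
  rw [norm_mul, norm_mul, Real.norm_eq_abs, Real.norm_eq_abs, Real.norm_eq_abs, abs_digitSign,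
    abs_permSign, mul_one, mul_one, abs_of_nonneg (by positivity)]

lemma treeReal_eq (d : ℕ → Fin 2) (π : TreeScramble) : treeReal d π = (1 + treeSum d π) / 2 := by
  unfold treeReal treeSum Real.ofDigits
  nth_rewrite 1 [← tsum_half_pow]
  rw [← summable_half_pow.tsum_add (summable_treeSum d π), ← tsum_div_const]
  refine tsum_congr fun k => ?_
  rw [Real.ofDigitsTerm, cast_eq_digitSign, digitSign_apply]
  simp only [Nat.cast_ofNat, one_div, inv_pow]
  ring

lemma measurable_treeReal (d : ℕ → Fin 2) : Measurable (treeReal d) := by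
  refine Real.continuous_ofDigits.measurable.comp (measurable_pi_lambda _ fun k => ?_)
  exact (measurable_from_top (f := fun σ : Equiv.Perm (Fin 2) => σ (d k))).comp
    (measurable_pi_apply _)

lemma treeReal_nonneg (d : ℕ → Fin 2) (π : TreeScramble) : 0 ≤ treeReal d π :=
  Real.ofDigits_nonneg _

lemma treeReal_le_one (d : ℕ → Fin 2) (π : TreeScramble) : treeReal d π ≤ 1 :=
  Real.ofDigits_le_one _

lemma measurable_treeSum (d : ℕ → Fin 2) : Measurable (treeSum d) := by
  have : treeSum d = fun π => 2 * treeReal d π - 1 := by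
    funext π; rw [treeReal_eq]; ring
  rw [this]
  exact ((measurable_treeReal d).const_mul 2).sub_const 1

lemma abs_treeSum_le (d : ℕ → Fin 2) (π : TreeScramble) : |treeSum d π| ≤ 1 := by
  have h := treeReal_eq d π
  have h0 := treeReal_nonneg d π
  have h1 := treeReal_le_one d π
  rw [abs_le]; constructor <;> linarith

lemma integrable_of_bounded {Ω : Type*} [MeasurableSpace Ω] {μ : Measure Ω} [IsFiniteMeasure μ]
    {f : Ω → ℝ} (hf : Measurable f) {C : ℝ} (hC : ∀ x, |f x| ≤ C) : Integrable f μ :=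
  Integrable.of_bound hf.aestronglyMeasurable C (Filter.Eventually.of_forall hC)

/-- Termwise integration, justified by the geometric majorant. It is used with `g` equal to 1, to a
single sign, and to `treeSum d` itself. -/
lemma hasSum_integral_mul_treeSum (d : ℕ → Fin 2) {g : TreeScramble → ℝ} (hg : Measurable g)
    (hg1 : ∀ π, |g π| ≤ 1) :
    HasSum (fun k : ℕ => (1 / 2 : ℝ) ^ (k + 1) * digitSign (d k) *
      ∫ π, g π * permSign (π (digitPrefix d k)) ∂treeLaw) (∫ π, g π * treeSum d π ∂treeLaw) := by
  have hb : ∀ k π, ‖(1 / 2 : ℝ) ^ (k + 1) * digitSign (d k) *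
      (g π * permSign (π (digitPrefix d k)))‖ ≤ (1 / 2 : ℝ) ^ (k + 1) := by
    intro k π
    simp only [norm_mul, Real.norm_eq_abs, abs_digitSign, abs_permSign, mul_one]
    rw [abs_of_nonneg (by positivity)]
    exact mul_le_of_le_one_right (by positivity) (hg1 π)
  have hm : ∀ k, Measurable fun π : TreeScramble => (1 / 2 : ℝ) ^ (k + 1) * digitSign (d k) *
      (g π * permSign (π (digitPrefix d k))) := fun k =>
    (hg.mul (measurable_permSign_apply _)).const_mul _
  have hi : ∀ k, Integrable (fun π : TreeScramble => (1 / 2 : ℝ) ^ (k + 1) * digitSign (d k) *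
      (g π * permSign (π (digitPrefix d k)))) treeLaw := fun k =>
    integrable_of_bounded (hm k) (hb k)
  have key := hasSum_integral_of_summable_integral_norm hi <| by
    refine Summable.of_nonneg_of_le (fun k => by positivity) (fun k => ?_) summable_half_pow
    calc _ ≤ ∫ _, (1 / 2 : ℝ) ^ (k + 1) ∂treeLaw :=
          integral_mono (hi k).norm (integrable_const _) (hb k)
      _ = _ := by simp
  simp only [integral_const_mul] at key
  have e : ∀ π, g π * treeSum d π = ∑' k : ℕ, (1 / 2 : ℝ) ^ (k + 1) * digitSign (d k) *
      (g π * permSign (π (digitPrefix d k))) := by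
    intro π
    unfold treeSum
    rw [← tsum_mul_left]
    exact tsum_congr fun k => by ring
  simpa only [e] using key

lemma integral_treeSum (d : ℕ → Fin 2) : ∫ π, treeSum d π ∂treeLaw = 0 := by
  have h := hasSum_integral_mul_treeSum d (g := fun _ => 1) measurable_const (by simp)
  simp only [one_mul, integral_permSign_apply, mul_zero] at h
  exact h.unique hasSum_zero

lemma integral_permSign_mul_treeSum (d : ℕ → Fin 2) (k : ℕ) :
    ∫ π, permSign (π (digitPrefix d k)) * treeSum d π ∂treeLaw =
      (1 / 2 : ℝ) ^ (k + 1) * digitSign (d k) := by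
  have h := hasSum_integral_mul_treeSum d (g := fun π => permSign (π (digitPrefix d k)))
    (measurable_permSign_apply _) (fun π => (abs_permSign _).le)
  simp only [integral_permSign_mul, (digitPrefix_injective d).eq_iff] at h
  refine h.unique ?_
  convert hasSum_ite_eq k ((1 / 2 : ℝ) ^ (k + 1) * digitSign (d k)) using 2 with l
  by_cases hl : l = k
  · simp [hl]
  · simp [hl, Ne.symm hl]

lemma integral_treeSum_sq (d : ℕ → Fin 2) : ∫ π, treeSum d π ^ 2 ∂treeLaw = 1 / 3 := by
  have h := hasSum_integral_mul_treeSum d (measurable_treeSum d) (abs_treeSum_le d)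
  simp_rw [mul_comm (treeSum d _) (permSign _), integral_permSign_mul_treeSum] at h
  simp_rw [pow_two]
  refine h.unique ?_
  have hg : HasSum (fun k : ℕ => (1 / 4 : ℝ) * (1 / 4) ^ k) (1 / 4 * (1 - 1 / 4)⁻¹) :=
    (hasSum_geometric_of_lt_one (by norm_num) (by norm_num)).mul_left _
  convert hg using 1
  · funext k
    have := digitSign_mul_self (d k)
    calc _ = (digitSign (d k) * digitSign (d k)) * ((1 / 2 : ℝ) ^ (k + 1) * (1 / 2) ^ (k + 1)) := by
          ring
      _ = _ := by rw [this, ← mul_pow, one_mul, pow_succ]; norm_num; ring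
  · norm_num

lemma integral_treeReal (d : ℕ → Fin 2) : ∫ π, treeReal d π ∂treeLaw = 1 / 2 := by
  simp_rw [treeReal_eq]
  rw [integral_div, integral_add (integrable_const _)
    (integrable_of_bounded (measurable_treeSum d) (abs_treeSum_le d)), integral_treeSum]
  simp

lemma integral_one_sub_treeReal_sq (d : ℕ → Fin 2) :
    ∫ π, (1 - treeReal d π ^ 2) / 2 ∂treeLaw = 1 / 3 := by
  have h1 : Integrable (treeSum d) treeLaw :=
    integrable_of_bounded (measurable_treeSum d) (abs_treeSum_le d)
  have h2 : Integrable (fun π => treeSum d π ^ 2) treeLaw :=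
    integrable_of_bounded (C := 1) ((measurable_treeSum d).pow_const 2) fun π => by
      rw [abs_pow]; exact pow_le_one₀ (abs_nonneg _) (abs_treeSum_le d π)
  have : ∀ π, (1 - treeReal d π ^ 2) / 2 = 3 / 8 - 1 / 4 * treeSum d π - 1 / 8 * treeSum d π ^ 2 := by
    intro π; rw [treeReal_eq]; ring
  simp_rw [this]
  rw [integral_sub (by fun_prop) (by fun_prop), integral_sub (by fun_prop) (by fun_prop),
    integral_const_mul, integral_const_mul, integral_treeSum, integral_treeSum_sq]
  simp; norm_num

/-! ### Scrambled values are almost surely below one. -/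

lemma permLaw_apply_eq_one (a : Fin 2) : permLaw {σ | σ a = 1} = 1 / 2 := by
  unfold permLaw
  rw [PMF.toMeasure_apply_fintype]
  have : (Finset.univ : Finset (Equiv.Perm (Fin 2))) = {1, Equiv.swap 0 1} := by decide
  rw [this, Finset.sum_pair (by decide)]
  fin_cases a <;> simp [Set.indicator_apply, Fintype.card_perm]

/-- The series `treeSum` attains its maximum 1 only if every term attains its own. -/
lemma apply_eq_one_of_treeReal_eq_one {d : ℕ → Fin 2} {π : TreeScramble} (h : treeReal d π = 1)
    (k : ℕ) : π (digitPrefix d k) (d k) = 1 := by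
  have hs : treeSum d π = 1 := by rw [treeReal_eq] at h; linarith
  have hz : HasSum (fun k : ℕ => (1 / 2 : ℝ) ^ (k + 1) -
      (1 / 2 : ℝ) ^ (k + 1) * digitSign (d k) * permSign (π (digitPrefix d k))) 0 := by
    have := (summable_half_pow.hasSum).sub (summable_treeSum d π).hasSum
    rw [tsum_half_pow] at this
    unfold treeSum at hs
    rwa [hs, sub_self] at this
  have hz' := (hasSum_zero_iff_of_nonneg fun k => ?_).1 hz
  · have := congrFun hz' k
    simp only [Pi.zero_apply, mul_assoc, ← digitSign_apply] at this
    have h0 : (0 : ℝ) < (1 / 2 : ℝ) ^ (k + 1) := by positivity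
    have h1 : digitSign (π (digitPrefix d k) (d k)) = 1 :=
      mul_left_cancel₀ h0.ne' (by linarith)
    by_contra hne
    have : π (digitPrefix d k) (d k) = 0 := by lia
    rw [this] at h1
    norm_num [digitSign] at h1
  · have h1 : digitSign (d k) * permSign (π (digitPrefix d k)) ≤ 1 :=
      le_of_abs_le (by rw [abs_mul, abs_digitSign, abs_permSign, one_mul])
    have h0 : (0 : ℝ) < (1 / 2 : ℝ) ^ (k + 1) := by positivity
    simp only [mul_assoc]
    nlinarith

lemma ae_treeReal_lt_one (d : ℕ → Fin 2) : ∀ᵐ π ∂treeLaw, treeReal d π < 1 := by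
  rw [ae_iff]
  have hle : ∀ n : ℕ, treeLaw {π | ¬ treeReal d π < 1} ≤ (1 / 2 : ℝ≥0∞) ^ n := by
    intro n
    -- A node on the path of `d` is determined by its length, so one family of sets indexed by lists
    -- encodes the first `n` conditions; they are independent, of probability one half each.
    let t : List (Fin 2) → Set (Equiv.Perm (Fin 2)) := fun l => {σ | σ (d l.length) = 1}
    calc treeLaw {π | ¬ treeReal d π < 1}
        ≤ treeLaw (Set.pi ((Finset.range n).image (digitPrefix d)) t) := by
          refine measure_mono fun π hπ l hl => ?_
          obtain ⟨k, -, rfl⟩ := Finset.mem_image.1 (Finset.mem_coe.1 hl)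
          have : (digitPrefix d k).length = k := by simp [digitPrefix]
          simp only [t, Set.mem_ofPred_eq, this]
          exact apply_eq_one_of_treeReal_eq_one
            (le_antisymm (treeReal_le_one d π) (not_lt.1 hπ)) k
      _ = (1 / 2 : ℝ≥0∞) ^ n := by
          unfold treeLaw
          rw [Measure.infinitePi_pi _ fun _ _ => MeasurableSet.of_discrete,
            Finset.prod_image fun _ _ _ _ h => digitPrefix_injective d h]
          simp only [t, permLaw_apply_eq_one, Finset.prod_const, Finset.card_range]
  refine le_antisymm (ge_of_tendsto' (ENNReal.tendsto_pow_atTop_nhds_zero_of_lt_one ?_) hle)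
    zero_le
  rw [one_div]; exact ENNReal.one_half_lt_one

/-- If two digit sequences differ for the first time at index `i`, then the order of their
scrambled values is decided by the permutation at their common prefix. -/
lemma abs_treeSum_sub {d d' : ℕ → Fin 2} {i : ℕ} (h : ∀ k < i, d k = d' k) (hi : d i ≠ d' i)
    (π : TreeScramble) :
    |treeSum d π - treeSum d' π| =
      digitSign (d i) * permSign (π (digitPrefix d i)) * (treeSum d π - treeSum d' π) := by
  set b := digitSign (d i) * permSign (π (digitPrefix d i)) with hb
  have hb1 : |b| = 1 := by rw [hb, abs_mul, abs_digitSign, abs_permSign, one_mul]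
  have hbb : b * b = 1 := by rw [← abs_mul_abs_self, hb1, one_mul]
  -- The digits before `i` cancel, digit `i` contributes `b / 2 ^ (i + 1)` to the difference, and
  -- the tails differ by at most `1 / 2 ^ (i + 1)`; hence `b` is a sign of the difference.
  suffices h0 : 0 ≤ b * (treeReal d π - treeReal d' π) by
    rw [treeReal_eq, treeReal_eq] at h0
    rw [← abs_of_nonneg (show 0 ≤ b * (treeSum d π - treeSum d' π) by linarith), abs_mul, hb1,
      one_mul]
  unfold treeReal
  rw [Real.ofDigits_eq_sum_add_ofDigits _ (i + 1),
    Real.ofDigits_eq_sum_add_ofDigits (fun k => π (digitPrefix d' k) (d' k)) (i + 1),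
    Finset.sum_range_succ, Finset.sum_range_succ]
  have hsum : ∑ k ∈ Finset.range i, Real.ofDigitsTerm (fun k => π (digitPrefix d k) (d k)) k =
      ∑ k ∈ Finset.range i, Real.ofDigitsTerm (fun k => π (digitPrefix d' k) (d' k)) k := by
    refine Finset.sum_congr rfl fun k hk => ?_
    have hk := Finset.mem_range.1 hk
    simp only [Real.ofDigitsTerm]
    rw [digitPrefix_congr fun l hl => h l (hl.trans hk), h k hk]
  have e1 : Real.ofDigitsTerm (fun k => π (digitPrefix d k) (d k)) i =
      (1 + b) / 2 * (2 ^ (i + 1))⁻¹ := by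
    rw [Real.ofDigitsTerm, cast_eq_digitSign, digitSign_apply]; norm_num [hb]
  have e2 : Real.ofDigitsTerm (fun k => π (digitPrefix d' k) (d' k)) i =
      (1 - b) / 2 * (2 ^ (i + 1))⁻¹ := by
    rw [Real.ofDigitsTerm, cast_eq_digitSign, digitSign_apply, digitSign_of_ne hi,
      ← digitPrefix_congr h]
    norm_num [hb]; ring
  rw [hsum, e1, e2]
  set x := Real.ofDigits fun k => π (digitPrefix d (k + (i + 1))) (d (k + (i + 1))) with hx
  set y := Real.ofDigits fun k => π (digitPrefix d' (k + (i + 1))) (d' (k + (i + 1))) with hy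
  have hxy : |x - y| ≤ 1 := by
    rw [abs_le]
    constructor <;> linarith [Real.ofDigits_nonneg fun k =>
      π (digitPrefix d (k + (i + 1))) (d (k + (i + 1))), Real.ofDigits_le_one fun k =>
      π (digitPrefix d (k + (i + 1))) (d (k + (i + 1))), Real.ofDigits_nonneg fun k =>
      π (digitPrefix d' (k + (i + 1))) (d' (k + (i + 1))), Real.ofDigits_le_one fun k =>
      π (digitPrefix d' (k + (i + 1))) (d' (k + (i + 1)))]
  have hbxy : -1 ≤ b * (x - y) := by
    have : |b * (x - y)| ≤ 1 := by rw [abs_mul, hb1, one_mul]; exact hxy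
    exact (abs_le.1 this).1
  have hpos : (0 : ℝ) ≤ (2 ^ (i + 1))⁻¹ := by positivity
  have := mul_nonneg hpos (show 0 ≤ 1 + b * (x - y) by linarith)
  calc (0 : ℝ) ≤ _ := this
    _ = (2 ^ (i + 1))⁻¹ * (b * b + b * (x - y)) := by rw [hbb]
    _ = _ := by push_cast; ring

/-- The maximum is half the sum plus half the absolute difference. The latter is a sign at the
common prefix times the difference, so orthogonality leaves only the coefficient of index `i`. -/
lemma integral_max_treeReal {d d' : ℕ → Fin 2} {i : ℕ} (h : ∀ k < i, d k = d' k)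
    (hi : d i ≠ d' i) :
    ∫ π, (1 - max (treeReal d π) (treeReal d' π)) ∂treeLaw = 1 / 2 - 1 / 4 * (1 / 2) ^ i := by
  have hint : ∀ d, Integrable (treeSum d) treeLaw := fun d =>
    integrable_of_bounded (measurable_treeSum d) (abs_treeSum_le d)
  have hint' : ∀ d l, Integrable (fun π => permSign (π l) * treeSum d π) treeLaw := fun d l =>
    integrable_of_bounded (C := 1)
      ((measurable_permSign_apply l).mul (measurable_treeSum d)) fun π => by
        rw [abs_mul, abs_permSign, one_mul]; exact abs_treeSum_le d π
  have hp := digitPrefix_congr h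
  have e : ∀ π, 1 - max (treeReal d π) (treeReal d' π) =
      1 / 2 - 1 / 4 * treeSum d π - 1 / 4 * treeSum d' π -
      (digitSign (d i) / 4 * (permSign (π (digitPrefix d i)) * treeSum d π) -
        digitSign (d i) / 4 * (permSign (π (digitPrefix d' i)) * treeSum d' π)) := by
    intro π
    have h1 := abs_treeSum_sub h hi π
    have h2 := max_add_min (treeReal d π) (treeReal d' π)
    have h3 := max_sub_min_eq_abs' (treeReal d π) (treeReal d' π)
    have h4 : treeReal d π - treeReal d' π = (treeSum d π - treeSum d' π) / 2 := by
      rw [treeReal_eq, treeReal_eq]; ring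
    rw [h4, abs_div, h1, abs_two] at h3
    rw [← hp]
    rw [treeReal_eq, treeReal_eq] at h2 h3 ⊢
    linarith
  simp_rw [e]
  rw [integral_sub (by fun_prop) (by fun_prop), integral_sub (by fun_prop) (by fun_prop),
    integral_sub (by fun_prop) (by fun_prop), integral_sub (by fun_prop) (by fun_prop)]
  simp only [integral_const_mul, integral_treeSum, integral_permSign_mul_treeSum,
    digitSign_of_ne hi]
  have := digitSign_mul_self (d i)
  simp only [integral_const, probReal_univ, smul_eq_mul]
  linear_combination (-(1 / 2 : ℝ) ^ (i + 1) / 2) * this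

lemma integral_max_treeReal_self (d : ℕ → Fin 2) :
    ∫ π, (1 - max (treeReal d π) (treeReal d π)) ∂treeLaw = 1 / 2 := by
  simp only [max_self]
  rw [integral_sub (integrable_const _), integral_treeReal]
  · simp; norm_num
  · exact integrable_of_bounded (measurable_treeReal d) fun π => by
      rw [abs_of_nonneg (treeReal_nonneg d π)]; exact treeReal_le_one d π

/-! ### Walsh series of the scrambled kernel -/

/-- The Walsh function of index `k` evaluated at a sequence of signs. -/
noncomputable def walsh (c : ℕ → ℝ) (k : ℕ) : ℝ :=
  ∏ i ∈ Finset.range k.size, if k.testBit i then c i else 1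

lemma testBit_eq_false_of_size_le {k i : ℕ} (h : k.size ≤ i) : k.testBit i = false :=
  Nat.testBit_lt_two_pow ((Nat.lt_size_self k).trans_le (Nat.pow_le_pow_right (by norm_num) h))

lemma walsh_eq_prod (c : ℕ → ℝ) {k M : ℕ} (h : k.size ≤ M) :
    walsh c k = ∏ i ∈ Finset.range M, if k.testBit i then c i else 1 := by
  refine Finset.prod_subset (Finset.range_mono h) fun i _ hi => ?_
  rw [testBit_eq_false_of_size_le (by simpa using hi)]
  simp

lemma walsh_zero (c : ℕ → ℝ) : walsh c 0 = 1 := by simp [walsh]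

lemma size_two_mul {k : ℕ} (h : k ≠ 0) : (2 * k).size = k.size + 1 := by
  simpa [Nat.bit] using Nat.size_bit (b := false) (n := k) (by simpa [Nat.bit] using h)

lemma size_two_mul_add_one (k : ℕ) : (2 * k + 1).size = k.size + 1 := by
  simpa [Nat.bit] using Nat.size_bit (b := true) (n := k) (by simp [Nat.bit])

lemma walsh_two_mul (c : ℕ → ℝ) (k : ℕ) : walsh c (2 * k) = walsh (fun i => c (i + 1)) k := by
  rcases eq_or_ne k 0 with rfl | hk
  · simp [walsh]
  · rw [walsh, size_two_mul hk, Finset.prod_range_succ']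
    simp [walsh, Nat.testBit_succ]

lemma walsh_two_mul_add_one (c : ℕ → ℝ) (k : ℕ) :
    walsh c (2 * k + 1) = c 0 * walsh (fun i => c (i + 1)) k := by
  rw [walsh, size_two_mul_add_one, Finset.prod_range_succ', mul_comm]
  have : ∀ i, (2 * k + 1).testBit (i + 1) = k.testBit i := fun i => by
    rw [Nat.testBit_succ]; congr 1; lia
  simp [walsh, this]

lemma walsh_mul (c c' : ℕ → ℝ) (k : ℕ) :
    walsh (fun i => c i * c' i) k = walsh c k * walsh c' k := by
  unfold walsh
  rw [← Finset.prod_mul_distrib]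
  exact Finset.prod_congr rfl fun i _ => by split_ifs <;> simp

lemma abs_walsh {c : ℕ → ℝ} (hc : ∀ i, |c i| = 1) (k : ℕ) : |walsh c k| = 1 := by
  unfold walsh
  rw [Finset.abs_prod]
  exact Finset.prod_eq_one fun i _ => by split_ifs <;> simp [hc]

/-! ### The coefficients `psi` and the sums of their powers. -/

lemma psi_zero : psi 0 = 1 := by simp [psi]

lemma psi_pos (k : ℕ) : 0 < psi k := by unfold psi; positivity

lemma psi_two_mul {k : ℕ} (h : k ≠ 0) : psi (2 * k) = psi k / 4 := by
  unfold psi; rw [size_two_mul h, pow_succ]; field_simp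

lemma psi_two_mul_add_one (k : ℕ) : psi (2 * k + 1) = psi k / 4 := by
  unfold psi; rw [size_two_mul_add_one, pow_succ]; field_simp

/-- Since `k < 2 ^ k.size`, the terms with `k ≥ 1` are at most `k ^ (-2 * lam)`. -/
lemma summable_psi_rpow {lam : ℝ} (h : 1 / 2 < lam) : Summable fun k => psi k ^ lam := by
  rw [← summable_nat_add_iff 1]
  have hs := (summable_nat_add_iff 1).2 (Real.summable_nat_rpow_inv.2 (show 1 < 2 * lam by linarith))
  refine Summable.of_nonneg_of_le (fun k => Real.rpow_nonneg (psi_pos _).le _) (fun k => ?_) hs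
  have hk : ((k + 1 : ℕ) : ℝ) ≤ 2 ^ (k + 1).size := by
    exact_mod_cast (Nat.lt_size_self (k + 1)).le
  have h0 : (0 : ℝ) < ((k + 1 : ℕ) : ℝ) := by positivity
  rw [Real.rpow_mul h0.le, ← Real.inv_rpow (by positivity)]
  refine Real.rpow_le_rpow (psi_pos _).le ?_ (by linarith)
  rw [psi, one_div]
  refine inv_anti₀ (by positivity) ?_
  rw [Real.rpow_two]
  calc _ ≤ ((2 : ℝ) ^ (k + 1).size) ^ 2 := by gcongr
    _ = _ := by rw [← pow_mul, mul_comm, pow_mul]; norm_num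

lemma summable_psi : Summable psi := by
  simpa using summable_psi_rpow (lam := 1) (by norm_num)

/-- Splitting by parity and isolating the index 0 gives `S = a * S + 1 + a * (S - 1)` for the sum
`S`. -/
lemma tsum_of_binary_recursion {f : ℕ → ℝ} {a : ℝ} (hf : Summable f) (h0 : f 0 = 1)
    (he : ∀ k, f (2 * (k + 1)) = a * f (k + 1)) (ho : ∀ k, f (2 * k + 1) = a * f k) :
    (∑' k, f k) * (1 - 2 * a) = 1 - a := by
  have hse : Summable fun k => f (2 * k) := hf.comp_injective (mul_right_injective₀ two_ne_zero)
  have hso : Summable fun k => f (2 * k + 1) :=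
    hf.comp_injective ((add_left_injective 1).comp (mul_right_injective₀ two_ne_zero))
  have h1 := tsum_even_add_odd hse hso
  have e0 := hf.tsum_eq_zero_add
  have e1 := hse.tsum_eq_zero_add
  simp only [ho, he, tsum_mul_left, Nat.mul_zero, h0] at h1 e0 e1
  rw [e1] at h1
  linear_combination -h1 - a * e0

lemma tsum_psi_rpow {lam : ℝ} (h : 1 / 2 < lam) :
    ∑' k, psi k ^ lam = ((2 : ℝ) ^ (2 * lam) - 1) / ((2 : ℝ) ^ (2 * lam) - 2) := by
  have h4 : (2 : ℝ) ^ (2 * lam) = 4 ^ lam := by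
    rw [Real.rpow_mul (by norm_num)]; norm_num
  have h2 : (2 : ℝ) < 4 ^ lam := by
    rw [← h4]
    calc (2 : ℝ) = 2 ^ (1 : ℝ) := by simp
      _ < _ := Real.rpow_lt_rpow_of_exponent_lt (by norm_num) (by linarith)
  have hd : ∀ k, (psi k / 4) ^ lam = ((4 : ℝ) ^ lam)⁻¹ * psi k ^ lam := fun k => by
    rw [Real.div_rpow (psi_pos k).le (by norm_num)]; ring
  have key := tsum_of_binary_recursion (a := ((4 : ℝ) ^ lam)⁻¹) (summable_psi_rpow h)
    (by rw [psi_zero, Real.one_rpow]) (fun k => by rw [psi_two_mul k.succ_ne_zero, hd])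
    (fun k => by rw [psi_two_mul_add_one, hd])
  rw [h4]
  generalize (4 : ℝ) ^ lam = x at *
  have hx : x ≠ 0 := by linarith
  rw [eq_div_iff (by linarith)]
  field_simp at key
  linarith

/-- The Walsh series with coefficients `ψ`. -/
noncomputable def walshSeries (c : ℕ → ℝ) : ℝ := ∑' k, psi k * walsh c k

lemma summable_walshSeries {c : ℕ → ℝ} (hc : ∀ i, |c i| = 1) :
    Summable fun k => psi k * walsh c k :=
  Summable.of_norm_bounded summable_psi fun k => by
    rw [norm_mul, Real.norm_eq_abs, Real.norm_eq_abs, abs_walsh hc, mul_one,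
      abs_of_pos (psi_pos k)]

/-- Removing the lowest binary digit of the index shifts the sign sequence: with `W` the shifted
series, even indices give `1 + (W - 1) / 4` and odd ones `c 0 * W / 4`. -/
lemma walshSeries_eq {c : ℕ → ℝ} (hc : ∀ i, |c i| = 1) :
    walshSeries c = 3 / 4 + (1 + c 0) / 4 * walshSeries fun i => c (i + 1) := by
  have hs := summable_walshSeries hc
  have hs1 := summable_walshSeries fun i => hc (i + 1)
  have he := hs.comp_injective (mul_right_injective₀ (two_ne_zero (α := ℕ)))
  have ho := hs.comp_injective
    ((add_left_injective 1).comp (mul_right_injective₀ (two_ne_zero (α := ℕ))))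
  have h1 := tsum_even_add_odd (f := fun k => psi k * walsh c k) he ho
  have e0 := hs1.tsum_eq_zero_add
  have e1 := he.tsum_eq_zero_add
  simp only [Function.comp_apply, Nat.mul_zero, psi_zero, walsh_zero, mul_one,
    psi_two_mul (Nat.succ_ne_zero _), walsh_two_mul, psi_two_mul_add_one,
    walsh_two_mul_add_one] at h1 e0 e1
  rw [e1] at h1
  have e2 : ∀ k, psi (k + 1) / 4 * walsh (fun i => c (i + 1)) (k + 1) =
      1 / 4 * (psi (k + 1) * walsh (fun i => c (i + 1)) (k + 1)) := fun k => by ring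
  have e3 : ∀ k, psi k / 4 * (c 0 * walsh (fun i => c (i + 1)) k) =
      c 0 / 4 * (psi k * walsh (fun i => c (i + 1)) k) := fun k => by ring
  simp only [e2, e3, tsum_mul_left] at h1
  unfold walshSeries
  linarith

lemma walshSeries_one : (walshSeries fun _ => 1) = 3 / 2 := by
  have := walshSeries_eq (c := fun _ => 1) (by simp)
  linarith

/-- A sign `-1` annihilates everything after it, leaving `3 / 4`; each earlier sign `1` applies the
map `w ↦ 3 / 4 + w / 2`, whose fixed point is `3 / 2`. -/
lemma walshSeries_of_first {i : ℕ} {c : ℕ → ℝ} (hc : ∀ i, |c i| = 1) (h : ∀ k < i, c k = 1)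
    (hi : c i = -1) : walshSeries c = 3 / 2 - 3 / 4 * (1 / 2) ^ i := by
  induction i generalizing c with
  | zero => rw [walshSeries_eq hc, hi]; norm_num
  | succ i ih =>
    rw [walshSeries_eq hc, h 0 (by lia), ih (fun i => hc (i + 1)) (fun k hk => h (k + 1) (by lia)) hi]
    ring

lemma integral_max_treeReal_eq_walshSeries (d d' : ℕ → Fin 2) :
    ∫ π, (1 - max (treeReal d π) (treeReal d' π)) ∂treeLaw =
      1 / 3 * walshSeries fun i => digitSign (d i) * digitSign (d' i) := by
  by_cases h : d = d'
  · subst h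
    simp only [integral_max_treeReal_self, digitSign_mul_self, walshSeries_one]
    norm_num
  · have hex : ∃ i, d i ≠ d' i := Function.ne_iff.1 h
    have hmin : ∀ k < Nat.find hex, d k = d' k := fun k hk => not_not.1 (Nat.find_min hex hk)
    have hi := Nat.find_spec hex
    rw [integral_max_treeReal hmin hi, walshSeries_of_first (i := Nat.find hex)]
    · ring
    · intro i; rw [abs_mul, abs_digitSign, abs_digitSign, one_mul]
    · intro k hk; rw [hmin k hk, digitSign_mul_self]
    · rw [digitSign_of_ne hi, mul_neg, digitSign_mul_self]

/-! ### The discrepancy of a deterministic point set -/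

/-- Points below 1 satisfy the conditions outside `u` automatically. A coordinate equal to 1 would
break this, hence the need for `ae_treeReal_lt_one`. -/
lemma localDiscrepancy_extendByOne {N s : ℕ} (y : Fin N → Fin s → ℝ)
    (hy : ∀ n j, y n j ∈ Set.Ico 0 1) (u : Finset (Fin s)) (t : u → ℝ) :
    localDiscrepancy y (extendByOne u t) =
      (∑ n, ∏ j : u, if y n j < t j then (1 : ℝ) else 0) / N - ∏ j, t j := by
  unfold localDiscrepancy
  have h1 : ∀ n, (∀ j, y n j ∈ Set.Ico 0 (extendByOne u t j)) ↔
      ∀ j ∈ (Finset.univ : Finset u), y n j < t j := by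
    intro n
    constructor
    · intro h j _
      have := (h j).2
      simpa [extendByOne] using this
    · intro h j
      refine ⟨(hy n j).1, ?_⟩
      unfold extendByOne
      split_ifs with hj
      · exact h ⟨j, hj⟩ (Finset.mem_univ _)
      · exact (hy n j).2
  have h2 : ∏ j, extendByOne u t j = ∏ j, t j := by
    rw [← Finset.prod_subset (Finset.subset_univ u), ← Finset.prod_coe_sort]
    · exact Finset.prod_congr rfl fun j _ => by simp [extendByOne]
    · intro j _ hj; simp [extendByOne, hj]
  rw [h2]
  congr 2
  classical
  simp_rw [h1, Finset.prod_boole]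
  rw [Nat.card_eq_fintype_card, Fintype.card_subtype, Finset.natCast_card_filter]
  exact Finset.sum_congr rfl fun n _ => by congr

/-- The uniform distribution on the unit interval. -/
noncomputable abbrev unitMeasure : Measure ℝ := volume.restrict (Set.Icc 0 1)

lemma restrict_Icc_eq_pi {ι : Type*} [Fintype ι] :
    (volume.restrict (Set.Icc (0 : ι → ℝ) 1)) = Measure.pi fun _ : ι => unitMeasure := by
  rw [← Set.pi_univ_Icc, volume_pi, Measure.restrict_pi_pi]
  rfl

lemma integral_unit_ite {a : ℝ} (ha : a ∈ Set.Icc 0 1) (g : ℝ → ℝ) :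
    ∫ t, (if a < t then g t else 0) ∂unitMeasure = ∫ t in a..1, g t := by
  have : (fun t => if a < t then g t else 0) = (Set.Ioi a).indicator g := by
    funext t; simp [Set.indicator_apply]
  rw [this, setIntegral_indicator measurableSet_Ioi, intervalIntegral.integral_of_le ha.2]
  congr 2
  ext t
  simp only [Set.mem_inter_iff, Set.mem_Icc, Set.mem_Ioi, Set.mem_Ioc]
  exact ⟨fun h => ⟨h.2, h.1.2⟩, fun h => ⟨⟨ha.1.trans h.1.le, h.2⟩, h.1⟩⟩

lemma integrable_unit_ite (a : ℝ) {g : ℝ → ℝ} (hg : Continuous g) :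
    Integrable (fun t => if a < t then g t else 0) unitMeasure := by
  have : (fun t => if a < t then g t else 0) = (Set.Ioi a).indicator g := by
    funext t; simp [Set.indicator_apply]
  rw [this]
  exact (hg.integrableOn_Icc).integrable.indicator measurableSet_Ioi

lemma ite_mul_ite_max (a b t : ℝ) :
    ((if a < t then (1 : ℝ) else 0) * if b < t then 1 else 0) = if max a b < t then 1 else 0 := by
  simp only [max_lt_iff]
  by_cases h1 : a < t <;> by_cases h2 : b < t <;> simp [h1, h2]

/-- The squared `L₂` norm of the local discrepancy over the face belonging to `u`. -/
noncomputable def faceDiscrepancy {N s : ℕ} (u : Finset (Fin s)) (y : Fin N → Fin s → ℝ) : ℝ :=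
  (∑ n, ∑ n', ∏ j ∈ u, (1 - max (y n j) (y n' j))) / N ^ 2 -
    2 / N * ∑ n, ∏ j ∈ u, (1 - y n j ^ 2) / 2 + 1 / 3 ^ u.card

/-- Warnock's formula. -/
lemma setIntegral_localDiscrepancy_sq {N s : ℕ} (y : Fin N → Fin s → ℝ)
    (hy : ∀ n j, y n j ∈ Set.Ico 0 1) (u : Finset (Fin s)) :
    ∫ t in Set.Icc (0 : u → ℝ) 1, |localDiscrepancy y (extendByOne u t)| ^ 2 =
      faceDiscrepancy u y := by
  rw [restrict_Icc_eq_pi]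
  have e : ∀ t : u → ℝ, |localDiscrepancy y (extendByOne u t)| ^ 2 =
      (∑ n, ∑ n', ∏ j : u, if max (y n j) (y n' j) < t j then (1 : ℝ) else 0) / N ^ 2 -
        2 / N * ∑ n, (∏ j : u, if y n j < t j then t j else 0) + ∏ j, t j ^ 2 := by
    intro t
    rw [sq_abs, localDiscrepancy_extendByOne y hy, sub_sq, div_pow, pow_two (∑ n, _),
      Finset.sum_mul_sum, Finset.prod_pow]
    simp_rw [← Finset.prod_mul_distrib, ite_mul_ite_max]
    congr 2
    rw [Finset.sum_div, Finset.mul_sum, Finset.sum_mul, Finset.mul_sum]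
    refine Finset.sum_congr rfl fun n _ => ?_
    have : ∏ j : u, (if y n j < t j then t j else 0) =
        (∏ j : u, if y n j < t j then (1 : ℝ) else 0) * ∏ j, t j := by
      rw [← Finset.prod_mul_distrib]
      exact Finset.prod_congr rfl fun j _ => by simp
    rw [this]; ring
  simp_rw [e]
  have i1 : ∀ n n', Integrable (fun t : u → ℝ =>
      ∏ j : u, if max (y n j) (y n' j) < t j then (1 : ℝ) else 0)
      (Measure.pi fun _ => unitMeasure) := fun n n' =>
    Integrable.fintype_prod (f := fun (j : u) t => if max (y n j) (y n' j) < t then (1 : ℝ) else 0)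
      fun j => integrable_unit_ite _ continuous_const
  have i2 : ∀ n, Integrable (fun t : u → ℝ => ∏ j : u, if y n j < t j then t j else 0)
      (Measure.pi fun _ => unitMeasure) := fun n =>
    Integrable.fintype_prod (f := fun (j : u) t => if y n j < t then t else 0)
      fun j => integrable_unit_ite _ continuous_id
  have i3 : Integrable (fun t : u → ℝ => ∏ j, t j ^ 2) (Measure.pi fun _ => unitMeasure) :=
    Integrable.fintype_prod (f := fun (_ : u) t => t ^ 2)
      fun j => ((continuous_pow 2).integrableOn_Icc).integrable
  have i1' : Integrable (fun t : u → ℝ => (∑ n, ∑ n', ∏ j : u,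
      if max (y n j) (y n' j) < t j then (1 : ℝ) else 0) / N ^ 2)
      (Measure.pi fun _ => unitMeasure) :=
    (integrable_finsetSum _ fun n _ => integrable_finsetSum _ fun n' _ => i1 n n').div_const _
  have i2' : Integrable (fun t : u → ℝ => 2 / N * ∑ n, ∏ j : u, if y n j < t j then t j else 0)
      (Measure.pi fun _ => unitMeasure) :=
    (integrable_finsetSum _ fun n _ => i2 n).const_mul _
  rw [integral_add (by exact i1'.sub i2') i3, integral_sub i1' i2', integral_div, integral_const_mul,
    integral_finsetSum _ fun n _ => i2 n,
    integral_finsetSum _ fun n _ => integrable_finsetSum _ fun n' _ => i1 n n']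
  unfold faceDiscrepancy
  congr 1
  · congr 1
    · congr 1
      refine Finset.sum_congr rfl fun n _ => ?_
      rw [integral_finsetSum _ fun n' _ => i1 n n']
      refine Finset.sum_congr rfl fun n' _ => ?_
      rw [integral_fintype_prod_eq_prod
        (fun (j : u) t => if max (y n j) (y n' j) < t then (1 : ℝ) else 0),
        ← Finset.prod_coe_sort u]
      refine Finset.prod_congr rfl fun j _ => ?_
      rw [integral_unit_ite ⟨le_max_of_le_left (hy n j).1, max_le (hy n j).2.le (hy n' j).2.le⟩]
      simp
    · congr 1
      refine Finset.sum_congr rfl fun n _ => ?_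
      rw [integral_fintype_prod_eq_prod (fun (j : u) t => if y n j < t then t else 0),
        ← Finset.prod_coe_sort u]
      refine Finset.prod_congr rfl fun j _ => ?_
      rw [integral_unit_ite ⟨(hy n j).1, (hy n j).2.le⟩]
      simp
  · rw [integral_fintype_prod_eq_prod (fun (_ : u) (t : ℝ) => t ^ 2)]
    have : ∫ t, t ^ 2 ∂unitMeasure = 1 / 3 := by
      rw [unitMeasure, integral_Icc_eq_integral_Ioc, ← intervalIntegral.integral_of_le zero_le_one,
        integral_pow]
      norm_num
    simp only [this, Finset.prod_const, Finset.card_univ, Fintype.card_coe]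
    rw [div_pow, one_pow]

/-! ### The expectation over all scrambles -/

/-- The scramble of the `j`-th coordinate. -/
def Scramble.tree {s : ℕ} (π : Scramble s) (j : Fin s) : TreeScramble := fun l => π (j, l)

lemma scramblePoint_eq {s : ℕ} (π : Scramble s) (x : Fin s → ℝ) (j : Fin s) :
    scramblePoint π x j = treeReal (Real.digits (x j) 2) (π.tree j) := rfl

instance (s : ℕ) : IsProbabilityMeasure (scrambleLaw s) := by
  unfold scrambleLaw; infer_instance

/-- Currying the infinite product shows that the scrambles of the coordinates are independent copies
of `treeLaw`. -/
lemma measurePreserving_tree (s : ℕ) :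
    MeasurePreserving (fun (π : Scramble s) j => π.tree j) (scrambleLaw s)
      (Measure.pi fun _ => treeLaw) := by
  refine ⟨measurable_pi_lambda _ fun j => measurable_pi_lambda _ fun l => measurable_pi_apply _, ?_⟩
  rw [← Measure.infinitePi_eq_pi]
  exact Measure.infinitePi_map_curry fun (_ : Fin s) (_ : List (Fin 2)) => permLaw

lemma integral_prod_tree {s : ℕ} (u : Finset (Fin s)) (g : Fin s → TreeScramble → ℝ)
    (hg : ∀ j, Measurable (g j)) :
    ∫ π, ∏ j ∈ u, g j (Scramble.tree π j) ∂(scrambleLaw s) = ∏ j ∈ u, ∫ τ, g j τ ∂treeLaw := by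
  have h := measurePreserving_tree s
  have hm : Measurable fun τ : Fin s → TreeScramble => ∏ j ∈ u, g j (τ j) :=
    Finset.measurable_prod _ fun j _ => (hg j).comp (measurable_pi_apply j)
  have e := integral_map (μ := scrambleLaw s) h.measurable.aemeasurable
    (f := fun τ : Fin s → TreeScramble => ∏ j ∈ u, g j (τ j)) hm.aestronglyMeasurable
  rw [← e, h.map_eq]
  -- Padding with the constant 1 outside `u` makes this a product over all coordinates; the padding
  -- integrates to 1.
  have e1 : ∀ τ : Fin s → TreeScramble,
      ∏ j ∈ u, g j (τ j) = ∏ j, (if j ∈ u then g j else 1) (τ j) := by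
    intro τ
    rw [← Finset.prod_subset (Finset.subset_univ u)]
    · exact Finset.prod_congr rfl fun j hj => by simp [hj]
    · intro j _ hj; simp [hj]
  simp_rw [e1]
  rw [integral_fintype_prod_eq_prod, ← Finset.prod_subset (Finset.subset_univ u)]
  · exact Finset.prod_congr rfl fun j hj => by simp [hj]
  · intro j _ hj; simp [hj]

lemma measurable_tree {s : ℕ} (j : Fin s) : Measurable fun π : Scramble s => π.tree j :=
  measurable_pi_lambda _ fun _ => measurable_pi_apply _

lemma ae_scramblePoint_mem {N s : ℕ} (x : Fin N → Fin s → ℝ) :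
    ∀ᵐ π ∂scrambleLaw s, ∀ n j, scramblePoint π (x n) j ∈ Set.Ico 0 1 := by
  rw [ae_all_iff]; intro n
  rw [ae_all_iff]; intro j
  have h := (measurePreserving_eval (fun _ : Fin s => treeLaw) j).comp (measurePreserving_tree s)
  filter_upwards [h.quasiMeasurePreserving.ae (ae_treeReal_lt_one (Real.digits (x n j) 2))]
    with π hπ
  rw [scramblePoint_eq]
  exact ⟨treeReal_nonneg _ _, hπ⟩

lemma weightedL2_sq {N s : ℕ} {γ : Finset (Fin s) → ℝ} (hγ : ∀ u, 0 ≤ γ u)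
    (y : Fin N → Fin s → ℝ) :
    weightedL2 γ y ^ 2 = ∑ u : Finset (Fin s) with u.Nonempty,
      γ u * ∫ t in Set.Icc (0 : u → ℝ) 1, |localDiscrepancy y (extendByOne u t)| ^ 2 :=
  Real.sq_sqrt <| Finset.sum_nonneg fun u _ =>
    mul_nonneg (hγ u) (integral_nonneg fun _ => by positivity)

/-- The mixed term has expectation `-2 / 3 ^ u.card`, whatever the points are; together with the
constant term it produces the `-1`. -/
lemma integral_faceDiscrepancy {N s : ℕ} (hN : N ≠ 0)
    (D : Fin N → Fin s → ℕ → Fin 2) (u : Finset (Fin s)) :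
    Integrable (fun π => faceDiscrepancy u fun n j => treeReal (D n j) (Scramble.tree π j))
      (scrambleLaw s) ∧
    ∫ π, faceDiscrepancy u (fun n j => treeReal (D n j) (Scramble.tree π j)) ∂(scrambleLaw s) =
      1 / 3 ^ u.card * ((∑ n, ∑ n', ∏ j ∈ u, walshSeries fun i =>
        digitSign (D n j i) * digitSign (D n' j i)) / N ^ 2 - 1) := by
  have hN' : (N : ℝ) ≠ 0 := Nat.cast_ne_zero.2 hN
  unfold faceDiscrepancy
  have m1 : ∀ n n' j, Measurable fun τ => 1 - max (treeReal (D n j) τ) (treeReal (D n' j) τ) :=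
    fun n n' j => ((measurable_treeReal _).max (measurable_treeReal _)).const_sub 1
  have m2 : ∀ n j, Measurable fun τ => (1 - treeReal (D n j) τ ^ 2) / 2 := fun n j =>
    (((measurable_treeReal _).pow_const 2).const_sub 1).div_const 2
  have b1 : ∀ n n' j τ, |1 - max (treeReal (D n j) τ) (treeReal (D n' j) τ)| ≤ 1 := by
    intro n n' j τ
    have h1 := treeReal_nonneg (D n j) τ
    have h2 := max_le (treeReal_le_one (D n j) τ) (treeReal_le_one (D n' j) τ)
    have h3 := le_max_left (treeReal (D n j) τ) (treeReal (D n' j) τ)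
    rw [abs_le]; constructor <;> linarith
  have b2 : ∀ n j τ, |(1 - treeReal (D n j) τ ^ 2) / 2| ≤ 1 := by
    intro n j τ
    have h1 := treeReal_nonneg (D n j) τ
    have h2 := treeReal_le_one (D n j) τ
    rw [abs_le]; constructor <;> nlinarith
  have i1 : ∀ n n', Integrable (fun π : Scramble s => ∏ j ∈ u,
      (1 - max (treeReal (D n j) (π.tree j)) (treeReal (D n' j) (π.tree j)))) (scrambleLaw s) :=
    fun n n' => integrable_of_bounded
      (Finset.measurable_prod _ fun j _ => (m1 n n' j).comp (measurable_tree j)) (C := 1)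
      fun π => by
        rw [Finset.abs_prod]
        exact Finset.prod_le_one (fun _ _ => abs_nonneg _) fun j _ => b1 n n' j _
  have i2 : ∀ n, Integrable (fun π : Scramble s => ∏ j ∈ u,
      (1 - treeReal (D n j) (π.tree j) ^ 2) / 2) (scrambleLaw s) :=
    fun n => integrable_of_bounded
      (Finset.measurable_prod _ fun j _ => (m2 n j).comp (measurable_tree j)) (C := 1)
      fun π => by
        rw [Finset.abs_prod]
        exact Finset.prod_le_one (fun _ _ => abs_nonneg _) fun j _ => b2 n j _
  have i1' : Integrable (fun π : Scramble s => (∑ n, ∑ n', ∏ j ∈ u,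
      (1 - max (treeReal (D n j) (π.tree j)) (treeReal (D n' j) (π.tree j)))) / (N : ℝ) ^ 2)
      (scrambleLaw s) :=
    (integrable_finsetSum _ fun n _ => integrable_finsetSum _ fun n' _ => i1 n n').div_const _
  have i2' : Integrable (fun π : Scramble s => 2 / (N : ℝ) * ∑ n, ∏ j ∈ u,
      (1 - treeReal (D n j) (π.tree j) ^ 2) / 2) (scrambleLaw s) :=
    (integrable_finsetSum _ fun n _ => i2 n).const_mul _
  refine ⟨(i1'.sub i2').add (integrable_const _), ?_⟩
  rw [integral_add (by exact i1'.sub i2') (integrable_const _), integral_sub i1' i2', integral_div,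
    integral_const_mul, integral_finsetSum _ fun n _ => i2 n,
    integral_finsetSum _ fun n _ => integrable_finsetSum _ fun n' _ => i1 n n']
  have e1 : ∀ n, ∫ π : Scramble s, ∑ n', ∏ j ∈ u,
      (1 - max (treeReal (D n j) (π.tree j)) (treeReal (D n' j) (π.tree j))) ∂(scrambleLaw s) =
      1 / 3 ^ u.card * ∑ n', ∏ j ∈ u, walshSeries fun i =>
        digitSign (D n j i) * digitSign (D n' j i) := by
    intro n
    rw [integral_finsetSum _ fun n' _ => i1 n n', Finset.mul_sum]
    refine Finset.sum_congr rfl fun n' _ => ?_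
    rw [integral_prod_tree u (fun j τ => 1 - max (treeReal (D n j) τ) (treeReal (D n' j) τ))
      (m1 n n')]
    simp_rw [integral_max_treeReal_eq_walshSeries]
    rw [Finset.prod_mul_distrib, Finset.prod_const, div_pow, one_pow]
  have e2 : ∀ n, ∫ π : Scramble s, ∏ j ∈ u, (1 - treeReal (D n j) (π.tree j) ^ 2) / 2
      ∂(scrambleLaw s) = 1 / 3 ^ u.card := by
    intro n
    rw [integral_prod_tree u (fun j τ => (1 - treeReal (D n j) τ ^ 2) / 2) (m2 n)]
    simp_rw [integral_one_sub_treeReal_sq]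
    rw [Finset.prod_const, div_pow, one_pow]
  simp_rw [e1, e2, ← Finset.mul_sum]
  simp only [integral_const, probReal_univ, Finset.sum_const, Finset.card_univ, Fintype.card_fin,
    nsmul_eq_mul, smul_eq_mul]
  field_simp
  ring

lemma meanSquareL2_eq {N s : ℕ} (hN : N ≠ 0) {γ : Finset (Fin s) → ℝ} (hγ : ∀ u, 0 ≤ γ u)
    (x : Fin N → Fin s → ℝ) :
    meanSquareL2 γ x = ∑ u : Finset (Fin s) with u.Nonempty,
      γ u / 3 ^ u.card * ((∑ n, ∑ n', ∏ j ∈ u, walshSeries fun i =>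
        digitSign (Real.digits (x n j) 2 i) * digitSign (Real.digits (x n' j) 2 i)) / N ^ 2 - 1) := by
  unfold meanSquareL2
  have e : ∀ᵐ π ∂scrambleLaw s, weightedL2 γ (fun n => scramblePoint π (x n)) ^ 2 =
      ∑ u : Finset (Fin s) with u.Nonempty,
        γ u * faceDiscrepancy u (fun n => scramblePoint π (x n)) := by
    filter_upwards [ae_scramblePoint_mem x] with π hπ
    rw [weightedL2_sq hγ]
    exact Finset.sum_congr rfl fun u _ => by rw [setIntegral_localDiscrepancy_sq _ hπ]
  have h : ∀ u : Finset (Fin s),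
      Integrable (fun π => faceDiscrepancy u fun n => scramblePoint π (x n)) (scrambleLaw s) ∧
      ∫ π, faceDiscrepancy u (fun n => scramblePoint π (x n)) ∂(scrambleLaw s) = _ :=
    integral_faceDiscrepancy hN fun n j => Real.digits (x n j) 2
  rw [integral_congr_ae e, integral_finsetSum _ fun u _ => (h u).1.const_mul _]
  refine Finset.sum_congr rfl fun u _ => ?_
  rw [integral_const_mul, (h u).2]
  ring

lemma initialMeanSquareL2_eq {s : ℕ} {γ : Finset (Fin s) → ℝ} (hγ : ∀ u, 0 ≤ γ u) :
    initialMeanSquareL2 γ = ∑ u : Finset (Fin s) with u.Nonempty, γ u / 3 ^ u.card := by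
  unfold initialMeanSquareL2 meanSquareL2
  have : ∀ y : Fin 0 → Fin s → ℝ, weightedL2 γ y ^ 2 =
      ∑ u : Finset (Fin s) with u.Nonempty, γ u / 3 ^ u.card := by
    intro y
    rw [weightedL2_sq hγ]
    refine Finset.sum_congr rfl fun u _ => ?_
    rw [setIntegral_localDiscrepancy_sq y fun n => n.elim0]
    simp [faceDiscrepancy, div_eq_mul_inv]
  simp [this]

/-! ### Polynomials and binary expansions -/

lemma coeff_truncPoly (m k i : ℕ) :
    (truncPoly m k).coeff i = if i < m ∧ k.testBit i then 1 else 0 := by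
  unfold truncPoly
  rw [Polynomial.finsetSum_coeff]
  have : ∀ l ∈ Finset.range m, (if k.testBit l then (Polynomial.X : Polynomial (ZMod 2)) ^ l
      else 0).coeff i = if i = l then (if k.testBit i then 1 else 0) else 0 := by
    intro l _
    by_cases h : k.testBit l <;> by_cases h' : i = l <;> simp_all [Polynomial.coeff_X_pow]
  rw [Finset.sum_congr rfl this, Finset.sum_ite_eq]
  by_cases h1 : i < m <;> by_cases h2 : k.testBit i <;> simp [h1, h2]

lemma degree_truncPoly_lt (m k : ℕ) : (truncPoly m k).degree < m := by
  rw [Polynomial.degree_lt_iff_coeff_zero]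
  intro i hi
  rw [coeff_truncPoly, if_neg (by lia)]

lemma natPoly_eq_truncPoly {m n : ℕ} (h : n < 2 ^ m) : natPoly n = truncPoly m n := by
  ext i
  rw [natPoly, coeff_truncPoly, coeff_truncPoly]
  have h1 : n.testBit i → i < m := fun hi => by
    by_contra hm
    rw [Nat.testBit_lt_two_pow (h.trans_le (Nat.pow_le_pow_right (by norm_num) (not_lt.1 hm)))] at hi
    simp at hi
  have h2 : n.testBit i → i < n.size := fun hi => by
    by_contra hm
    rw [testBit_eq_false_of_size_le (not_lt.1 hm)] at hi
    simp at hi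
  congr 1
  simp only [eq_iff_iff]
  tauto

lemma truncPoly_injective {m k l : ℕ} (hk : k < 2 ^ m) (hl : l < 2 ^ m)
    (h : truncPoly m k = truncPoly m l) : k = l := by
  refine Nat.eq_of_testBit_eq fun i => ?_
  by_cases hi : i < m
  · have := congrArg (fun f => f.coeff i) h
    simp only [coeff_truncPoly, hi, true_and] at this
    cases h1 : k.testBit i <;> cases h2 : l.testBit i <;> simp_all
  · have hm : 2 ^ m ≤ 2 ^ i := Nat.pow_le_pow_right (by norm_num) (not_lt.1 hi)
    rw [Nat.testBit_lt_two_pow (hk.trans_le hm), Nat.testBit_lt_two_pow (hl.trans_le hm)]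

lemma exists_truncPoly_eq {m : ℕ} {f : Polynomial (ZMod 2)} (hf : f.degree < m) :
    ∃ n < 2 ^ m, truncPoly m n = f := by
  refine ⟨Nat.ofBits fun i : Fin m => decide (f.coeff i = 1), Nat.ofBits_lt_two_pow _, ?_⟩
  ext i
  rw [coeff_truncPoly]
  by_cases hi : i < m
  · rw [Nat.testBit_ofBits_lt _ _ hi]
    have h01 : ∀ a : ZMod 2, (if a = 1 then 1 else 0) = a := by decide
    simpa [hi] using h01 (f.coeff i)
  · rw [if_neg (by tauto)]
    exact (((Polynomial.degree_lt_iff_coeff_zero f m).1 hf) i (not_lt.1 hi)).symm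

lemma truncPoly_eq_zero_iff {m k : ℕ} : truncPoly m k = 0 ↔ 2 ^ m ∣ k := by
  have h0 : truncPoly m (k % 2 ^ m) = truncPoly m k := by
    ext i
    rw [coeff_truncPoly, coeff_truncPoly, Nat.testBit_mod_two_pow]
    by_cases hi : i < m <;> simp [hi]
  have hz : truncPoly m 0 = 0 := by simp [truncPoly]
  rw [Nat.dvd_iff_mod_eq_zero, ← h0]
  refine ⟨fun h => truncPoly_injective (Nat.mod_lt _ (by positivity)) (by positivity)
    (h.trans hz.symm), fun h => by rw [h, hz]⟩

lemma truncPoly_zero (m : ℕ) : truncPoly m 0 = 0 := by simp [truncPoly]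

/-! ### Laurent coefficients of rational functions -/

lemma toLaurent_mul (f g : Polynomial (ZMod 2)) :
    toLaurent (f * g) = toLaurent f * toLaurent g := map_mul _ _ _

lemma toLaurent_add (f g : Polynomial (ZMod 2)) :
    toLaurent (f + g) = toLaurent f + toLaurent g := map_add _ _ _

lemma toLaurent_X_pow (i : ℕ) :
    toLaurent (Polynomial.X ^ i) = HahnSeries.single (-(i : ℤ)) (1 : ZMod 2) := by
  unfold toLaurent
  rw [map_pow, Polynomial.aeval_X, HahnSeries.single_pow]
  simp

lemma coeff_toLaurent (f : Polynomial (ZMod 2)) (l : ℤ) :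
    (toLaurent f).coeff l = if l ≤ 0 then f.coeff l.natAbs else 0 := by
  have h : toLaurent f = ∑ i ∈ Finset.range (f.natDegree + 1),
      HahnSeries.single (-(i : ℤ)) (f.coeff i) := by
    unfold toLaurent
    rw [Polynomial.aeval_def, Polynomial.eval₂_eq_sum_range, Subsingleton.elim
      (algebraMap (ZMod 2) (LaurentSeries (ZMod 2))) HahnSeries.C]
    refine Finset.sum_congr rfl fun i _ => ?_
    rw [HahnSeries.single_pow, HahnSeries.C_apply, HahnSeries.single_mul_single]
    simp
  rw [h, HahnSeries.coeff_sum]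
  simp only [HahnSeries.coeff_single]
  split_ifs with hl
  · by_cases hd : l.natAbs < f.natDegree + 1
    · rw [Finset.sum_eq_single_of_mem l.natAbs (Finset.mem_range.2 hd)]
      · rw [if_pos (by lia)]
      · intro i _ hi; rw [if_neg (by lia)]
    · rw [Polynomial.coeff_eq_zero_of_natDegree_lt (by lia)]
      refine Finset.sum_eq_zero fun i hi => ?_
      rw [Finset.mem_range] at hi
      rw [if_neg (by lia)]
  · exact Finset.sum_eq_zero fun i _ => if_neg (by lia)

/-- The coefficient of `x⁻¹` in the Laurent expansion of `f / p`. -/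
noncomputable def residue (p f : Polynomial (ZMod 2)) : ZMod 2 :=
  (toLaurent f / toLaurent p).coeff 1

lemma residue_add (p f g : Polynomial (ZMod 2)) :
    residue p (f + g) = residue p f + residue p g := by
  simp [residue, toLaurent_add, add_div]

lemma residue_zero (p : Polynomial (ZMod 2)) : residue p 0 = 0 := by
  simp [residue, toLaurent]

lemma residue_sum {ι : Type*} (p : Polynomial (ZMod 2)) (s : Finset ι)
    (f : ι → Polynomial (ZMod 2)) : residue p (∑ i ∈ s, f i) = ∑ i ∈ s, residue p (f i) := by
  classical
  induction s using Finset.induction_on with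
  | empty => simp [residue_zero]
  | insert a s ha ih => rw [Finset.sum_insert ha, Finset.sum_insert ha, residue_add, ih]

lemma toLaurent_ne_zero {p : Polynomial (ZMod 2)} (hp : p ≠ 0) : toLaurent p ≠ 0 := by
  intro h
  apply hp
  ext i
  have := congrArg (fun f => f.coeff (-(i : ℤ))) h
  simpa [coeff_toLaurent] using this

lemma residue_mul_self {p : Polynomial (ZMod 2)} (hp : p ≠ 0) (g : Polynomial (ZMod 2)) :
    residue p (p * g) = 0 := by
  unfold residue
  rw [toLaurent_mul, mul_div_cancel_left₀ _ (toLaurent_ne_zero hp), coeff_toLaurent]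
  simp

/-- Multiplication by `x ^ i` shifts the Laurent series, so every digit of a lattice point is a
residue. -/
lemma residue_X_pow_mul (p f : Polynomial (ZMod 2)) (i : ℕ) :
    residue p (Polynomial.X ^ i * f) = (toLaurent f / toLaurent p).coeff (i + 1 : ℤ) := by
  unfold residue
  rw [toLaurent_mul, mul_div_assoc, toLaurent_X_pow]
  have := HahnSeries.coeff_single_mul_add (r := (1 : ZMod 2)) (x := toLaurent f / toLaurent p)
    (a := (i + 1 : ℤ)) (b := -(i : ℤ))
  simpa using this

/-- The series `1 / p` has order at least `deg p ≥ 1`, so its leading coefficient sits at a positive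
index and is such a residue. -/
lemma exists_residue_X_pow_ne_zero {p : Polynomial (ZMod 2)} (hp : 0 < p.natDegree) :
    ∃ i : ℕ, residue p (Polynomial.X ^ i) ≠ 0 := by
  have hp0 : p ≠ 0 := fun h => by simp [h] at hp
  have hL := toLaurent_ne_zero hp0
  have ho : (toLaurent p).order ≤ -(p.natDegree : ℤ) := by
    refine HahnSeries.order_le_of_coeff_ne_zero ?_
    rw [coeff_toLaurent, if_pos (by lia)]
    simpa using hp0
  have hsum : (toLaurent p).order + (toLaurent p)⁻¹.order = 0 := by
    rw [← HahnSeries.order_mul hL (inv_ne_zero hL), mul_inv_cancel₀ hL, HahnSeries.order_one]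
  refine ⟨((toLaurent p)⁻¹.order - 1).toNat, ?_⟩
  have h1 := residue_X_pow_mul p 1 ((toLaurent p)⁻¹.order - 1).toNat
  rw [mul_one] at h1
  have h2 : toLaurent 1 = 1 := by simp [toLaurent]
  rw [h1, h2, one_div, Int.toNat_of_nonneg (by lia), sub_add_cancel]
  exact HahnSeries.coeff_order_eq_zero.not.2 (inv_ne_zero hL)

lemma exists_residue_mul_ne_zero {p h : Polynomial (ZMod 2)} {m : ℕ} (hp : Irreducible p)
    (hm : p.natDegree = m) (hh : ¬ p ∣ h) :
    ∃ n < 2 ^ m, residue p (truncPoly m n * h) ≠ 0 := by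
  obtain ⟨i, hi⟩ := exists_residue_X_pow_ne_zero hp.natDegree_pos
  -- Here `b` inverts `h` modulo `p`; taking for `n` the remainder of `x ^ i * b` makes the product
  -- with `h` congruent to `x ^ i`.
  obtain ⟨a, b, hab⟩ := (hp.coprime_iff_not_dvd.2 hh)
  have hd : ((Polynomial.X ^ i * b) % p).degree < (m : WithBot ℕ) := by
    rw [← hm, ← Polynomial.degree_eq_natDegree hp.ne_zero]
    exact EuclideanDomain.mod_lt _ hp.ne_zero
  obtain ⟨n, hn, hn'⟩ := exists_truncPoly_eq hd
  refine ⟨n, hn, ?_⟩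
  rw [hn']
  convert hi using 1
  have e : Polynomial.X ^ i = p * (Polynomial.X ^ i * a + (Polynomial.X ^ i * b) / p * h) +
      (Polynomial.X ^ i * b) % p * h := by
    have := EuclideanDomain.div_add_mod (Polynomial.X ^ i * b) p
    linear_combination (-Polynomial.X ^ i) * hab - h * this
  conv_rhs => rw [e]
  rw [residue_add, residue_mul_self hp.ne_zero, zero_add]

/-! ### The character sum over a polynomial lattice -/

/-- The nontrivial character of `𝔽₂`. -/
noncomputable def chi (a : ZMod 2) : ℝ := if a = 0 then 1 else -1

lemma chi_zero : chi 0 = 1 := by simp [chi]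

lemma chi_add (a b : ZMod 2) : chi (a + b) = chi a * chi b := by
  have h : ∀ a b : ZMod 2, a + b = 0 ↔ (a = 0 ↔ b = 0) := by decide
  unfold chi
  have := h a b
  by_cases h1 : a = 0 <;> by_cases h2 : b = 0 <;> simp_all

lemma chi_sum {ι : Type*} (s : Finset ι) (f : ι → ZMod 2) :
    chi (∑ i ∈ s, f i) = ∏ i ∈ s, chi (f i) := by
  classical
  induction s using Finset.induction_on with
  | empty => simp [chi_zero]
  | insert a s ha ih => rw [Finset.sum_insert ha, Finset.prod_insert ha, chi_add, ih]

lemma truncPoly_xor (m k l : ℕ) : truncPoly m (k ^^^ l) = truncPoly m k + truncPoly m l := by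
  ext i
  rw [Polynomial.coeff_add, coeff_truncPoly, coeff_truncPoly, coeff_truncPoly, Nat.testBit_xor]
  have : (1 : ZMod 2) + 1 = 0 := by decide
  by_cases hi : i < m <;> cases k.testBit i <;> cases l.testBit i <;> simp [hi, this]

/-- Orthogonality of characters: if `p ∤ h`, translating by some `n₀` with character value `-1`
turns the sum into its negative. -/
lemma sum_chi_residue {p h : Polynomial (ZMod 2)} {m : ℕ} (hp : Irreducible p)
    (hm : p.natDegree = m) [Decidable (p ∣ h)] :
    ∑ n : Fin (2 ^ m), chi (residue p (truncPoly m n * h)) = if p ∣ h then 2 ^ m else 0 := by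
  split_ifs with hd
  · obtain ⟨g, rfl⟩ := hd
    have : ∀ n : ℕ, residue p (truncPoly m n * (p * g)) = 0 := fun n => by
      rw [show truncPoly m n * (p * g) = p * (truncPoly m n * g) by ring,
        residue_mul_self hp.ne_zero]
    simp [this, chi_zero]
  · obtain ⟨n₀, hn₀, hr⟩ := exists_residue_mul_ne_zero hp hm hd
    rw [Fin.sum_univ_eq_sum_range fun n => chi (residue p (truncPoly m n * h))]
    have e : ∑ n ∈ Finset.range (2 ^ m), chi (residue p (truncPoly m n * h)) =
        ∑ n ∈ Finset.range (2 ^ m), chi (residue p (truncPoly m (n ^^^ n₀) * h)) := by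
      refine Finset.sum_nbij' (fun n => n ^^^ n₀) (fun n => n ^^^ n₀) ?_ ?_ ?_ ?_ ?_
      · intro n hn
        exact Finset.mem_range.2 (Nat.xor_lt_two_pow (Finset.mem_range.1 hn) hn₀)
      · intro n hn
        exact Finset.mem_range.2 (Nat.xor_lt_two_pow (Finset.mem_range.1 hn) hn₀)
      · intro n _; simp
      · intro n _; simp
      · intro n _; simp
    have hc : chi (residue p (truncPoly m n₀ * h)) = -1 := by simp [chi, hr]
    simp_rw [truncPoly_xor, add_mul, residue_add, chi_add, hc, ← Finset.sum_mul] at e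
    linarith

/-! ### The digits of the points -/

lemma ofDigits_lt_one {a : ℕ → Fin 2} (h : ∃ k, a k = 0) : Real.ofDigits a < 1 := by
  refine lt_of_le_of_ne (Real.ofDigits_le_one a) fun h1 => ?_
  obtain ⟨k, hk⟩ := h
  -- Under the identity scramble `treeReal` is the plain digit expansion.
  have := apply_eq_one_of_treeReal_eq_one (d := a) (π := fun _ => 1) h1 k
  simp [hk] at this

/-- The hypothesis excludes a tail of ones. Every tail is then less than 1, so the floor defining a
digit reads off exactly the integer part. -/
lemma digits_ofDigits {a : ℕ → Fin 2} (h : ∀ n, ∃ k, a (k + n) = 0) :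
    Real.digits (Real.ofDigits a) 2 = a := by
  have hstep : ∀ i, Real.ofDigits (fun k => a (k + i)) =
      ((a i : ℕ) + Real.ofDigits fun k => a (k + (i + 1))) / 2 := by
    intro i
    rw [Real.ofDigits_eq_sum_add_ofDigits _ 1]
    simp only [Finset.range_one, Finset.sum_singleton, Real.ofDigitsTerm]
    simp only [zero_add, pow_one, Nat.cast_ofNat, add_assoc, add_comm 1 i]
    ring
  have hA : ∀ i, ∃ A : ℕ, Real.ofDigits a * 2 ^ i = A + Real.ofDigits fun k => a (k + i) := by
    intro i
    induction i with
    | zero => exact ⟨0, by simp⟩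
    | succ i ih =>
      obtain ⟨A, hA⟩ := ih
      refine ⟨2 * A + a i, ?_⟩
      rw [pow_succ, ← mul_assoc, hA, hstep]
      push_cast; ring
  funext i
  obtain ⟨A, hA⟩ := hA i
  have hf : ⌊Real.ofDigits a * ((2 : ℕ) : ℝ) ^ (i + 1)⌋₊ = 2 * A + a i := by
    rw [Nat.floor_eq_iff (mul_nonneg (Real.ofDigits_nonneg a) (by positivity))]
    have e : Real.ofDigits a * ((2 : ℕ) : ℝ) ^ (i + 1) =
        2 * A + (a i : ℕ) + Real.ofDigits fun k => a (k + (i + 1)) := by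
      rw [Nat.cast_ofNat, pow_succ, ← mul_assoc, hA, hstep]; ring
    rw [e]
    have h0 := Real.ofDigits_nonneg fun k => a (k + (i + 1))
    have h1 := ofDigits_lt_one (h (i + 1))
    push_cast
    constructor <;> linarith
  unfold Real.digits
  rw [hf]
  ext
  simp only [Fin.val_ofNat]
  lia

/-- An element of `𝔽₂` as a dyadic digit. -/
def toDigit (a : ZMod 2) : Fin 2 := if a = 0 then 0 else 1

lemma coe_toDigit (a : ZMod 2) : ((toDigit a : Fin 2) : ℕ) = a.val := by
  revert a; decide

lemma vMap_eq_ofDigits (m : ℕ) (L : LaurentSeries (ZMod 2)) :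
    vMap m L = Real.ofDigits fun i : ℕ => if i < m then toDigit (L.coeff (i + 1 : ℤ)) else 0 := by
  unfold vMap Real.ofDigits
  rw [tsum_eq_sum (s := Finset.range m)]
  · rw [← Finset.Ico_add_one_right_eq_Icc, Finset.sum_Ico_eq_sum_range, Nat.add_sub_cancel]
    refine Finset.sum_congr rfl fun i hi => ?_
    rw [Finset.mem_range] at hi
    simp only [Real.ofDigitsTerm, hi, if_true, coe_toDigit]
    rw [add_comm 1 i, div_eq_mul_inv]
    push_cast
    rfl
  · intro i hi
    rw [Finset.mem_range] at hi
    simp [Real.ofDigitsTerm, hi]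

lemma digits_vMap (m : ℕ) (L : LaurentSeries (ZMod 2)) :
    Real.digits (vMap m L) 2 =
      fun i : ℕ => if i < m then toDigit (L.coeff (i + 1 : ℤ)) else 0 := by
  rw [vMap_eq_ofDigits]
  exact digits_ofDigits fun n => ⟨m, if_neg (by lia)⟩

/-- The minus sign is harmless: digit signs occur only in products of two. -/
lemma digitSign_toDigit (a : ZMod 2) : digitSign (toDigit a) = -chi a := by
  unfold digitSign chi toDigit
  by_cases h : a = 0 <;> simp [h]

lemma walsh_residue (m : ℕ) (p f : Polynomial (ZMod 2)) (k : ℕ) :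
    walsh (fun i => if i < m then chi (residue p (Polynomial.X ^ i * f)) else 1) k =
      chi (residue p (truncPoly m k * f)) := by
  rw [walsh_eq_prod _ (le_max_left k.size m), truncPoly, Finset.sum_mul, residue_sum, chi_sum,
    ← Finset.prod_subset (Finset.range_mono (le_max_right k.size m))]
  · refine Finset.prod_congr rfl fun i hi => ?_
    rw [Finset.mem_range] at hi
    by_cases hk : k.testBit i <;> simp [hk, hi, residue_zero, chi_zero]
  · intro i _ hi
    rw [Finset.mem_range] at hi
    simp [hi]

lemma walshSeries_latticePoint {s m : ℕ} (p : Polynomial (ZMod 2))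
    (q : Fin s → Polynomial (ZMod 2)) (n n' : Fin (2 ^ m)) (j : Fin s) :
    (walshSeries fun i => digitSign (Real.digits (latticePoint m p q n j) 2 i) *
      digitSign (Real.digits (latticePoint m p q n' j) 2 i)) =
    ∑' k, psi k * (chi (residue p (truncPoly m k * (truncPoly m n * q j))) *
      chi (residue p (truncPoly m k * (truncPoly m n' * q j)))) := by
  unfold walshSeries latticePoint
  refine tsum_congr fun k => ?_
  rw [← walsh_residue, ← walsh_residue, ← walsh_mul]
  congr 2
  funext i
  rw [digits_vMap, digits_vMap, natPoly_eq_truncPoly n.2, natPoly_eq_truncPoly n'.2]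
  by_cases hi : i < m
  · simp only [hi, if_true, digitSign_toDigit, residue_X_pow_mul, toLaurent_mul]
    ring
  -- Beyond position `m` both points have digit 0, and the product of the two signs `-1` is 1.
  · simp [hi, digitSign]

/-! ### The mean square discrepancy as a sum over the dual lattice -/

lemma hasSum_pi_prod {s : ℕ} (f : Fin s → ℕ → ℝ) (hf : ∀ j, Summable fun k => ‖f j k‖) :
    (Summable fun k : Fin s → ℕ => ‖∏ j, f j (k j)‖) ∧
      HasSum (fun k : Fin s → ℕ => ∏ j, f j (k j)) (∏ j, ∑' k, f j k) := by
  induction s with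
  | zero => exact ⟨(hasSum_unique _).summable, by simp⟩
  | succ s ih =>
    obtain ⟨h1, h2⟩ := ih (fun j => f j.succ) fun j => hf j.succ
    let g : (Fin s → ℕ) → ℝ := fun k => ∏ j, f j.succ (k j)
    have h3 : Summable fun x : ℕ × (Fin s → ℕ) => ‖f 0 x.1 * g x.2‖ :=
      Summable.mul_norm (f := f 0) (g := g) (hf 0) h1
    have h4 : HasSum (fun x : ℕ × (Fin s → ℕ) => f 0 x.1 * g x.2)
        ((∑' k, f 0 k) * ∏ j : Fin s, ∑' k, f j.succ k) :=
      HasSum.mul (f := f 0) (g := g) (hf 0).of_norm.hasSum h2 h3.of_norm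
    have e : ∀ x : ℕ × (Fin s → ℕ), f 0 x.1 * g x.2 =
        ∏ j, f j (Fin.consEquiv (fun _ : Fin (s + 1) => ℕ) x j) := by
      intro x
      rw [Fin.prod_univ_succ]
      rfl
    simp only [e] at h3 h4
    rw [Fin.prod_univ_succ]
    exact ⟨(Fin.consEquiv fun _ : Fin (s + 1) => ℕ).summable_iff.1 h3,
      (Fin.consEquiv fun _ : Fin (s + 1) => ℕ).hasSum_iff.1 h4⟩

/-- The set of nonzero components. -/
def supp {s : ℕ} (k : Fin s → ℕ) : Finset (Fin s) := Finset.univ.filter fun j => k j ≠ 0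

lemma mem_supp {s : ℕ} {k : Fin s → ℕ} {j : Fin s} : j ∈ supp k ↔ k j ≠ 0 := by simp [supp]

lemma supp_eq_iff {s : ℕ} {k : Fin s → ℕ} {v : Finset (Fin s)} :
    supp k = v ↔ ∀ j, k j ≠ 0 ↔ j ∈ v := by
  rw [Finset.ext_iff]
  simp only [mem_supp]

lemma supp_subset_iff {s : ℕ} {k : Fin s → ℕ} {u : Finset (Fin s)} :
    supp k ⊆ u ↔ ∀ j, j ∉ u → k j = 0 := by
  simp only [Finset.subset_iff, mem_supp]
  exact forall_congr' fun j => not_imp_comm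

lemma supp_eq_empty_iff {s : ℕ} {k : Fin s → ℕ} : supp k = ∅ ↔ k = 0 := by
  rw [supp_eq_iff]
  simp [funext_iff]

/-- The product of the factors `ψ(k_j)`. -/
noncomputable def psiProd {s : ℕ} (k : Fin s → ℕ) : ℝ := ∏ j, psi (k j)

lemma psiProd_pos {s : ℕ} (k : Fin s → ℕ) : 0 < psiProd k :=
  Finset.prod_pos fun _ _ => psi_pos _

lemma summable_psiProd (s : ℕ) : Summable (psiProd : (Fin s → ℕ) → ℝ) :=
  (hasSum_pi_prod (fun _ : Fin s => psi) fun _ => summable_psi.norm).2.summable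

lemma abs_chi (a : ZMod 2) : |chi a| = 1 := by unfold chi; split_ifs <;> norm_num

open Classical in
lemma hasSum_prod_walshSeries {s m : ℕ} (p : Polynomial (ZMod 2))
    (q : Fin s → Polynomial (ZMod 2)) (u : Finset (Fin s)) (n n' : Fin (2 ^ m)) :
    HasSum (fun k : Fin s → ℕ => (if supp k ⊆ u then psiProd k else 0) *
      (chi (residue p (truncPoly m n * ∑ j, truncPoly m (k j) * q j)) *
        chi (residue p (truncPoly m n' * ∑ j, truncPoly m (k j) * q j))))
      (∏ j ∈ u, walshSeries fun i => digitSign (Real.digits (latticePoint m p q n j) 2 i) *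
        digitSign (Real.digits (latticePoint m p q n' j) 2 i)) := by
  let g : Fin s → ℕ → ℝ := fun j k => psi k *
    (chi (residue p (truncPoly m k * (truncPoly m n * q j))) *
      chi (residue p (truncPoly m k * (truncPoly m n' * q j))))
  -- Outside `u` the factor is the indicator of 0, which turns the product over `u` into a sum over
  -- full vectors supported in `u`.
  let f : Fin s → ℕ → ℝ := fun j k => if j ∈ u then g j k else if k = 0 then 1 else 0
  have hg : ∀ j, Summable fun k => ‖g j k‖ := fun j => by
    refine summable_psi.congr fun k => ?_
    simp only [g, Real.norm_eq_abs, abs_mul, abs_chi, mul_one, abs_of_pos (psi_pos k)]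
  have hf : ∀ j, Summable fun k => ‖f j k‖ := fun j => by
    by_cases hj : j ∈ u
    · simpa only [f, hj, if_true] using hg j
    · simp only [f, hj, if_false]
      exact (hasSum_ite_eq 0 (1 : ℝ)).summable.norm
  have key := (hasSum_pi_prod f hf).2
  have e1 : ∏ j, ∑' k, f j k = ∏ j ∈ u, walshSeries fun i =>
      digitSign (Real.digits (latticePoint m p q n j) 2 i) *
        digitSign (Real.digits (latticePoint m p q n' j) 2 i) := by
    rw [← Finset.prod_subset (Finset.subset_univ u)]
    · refine Finset.prod_congr rfl fun j hj => ?_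
      rw [walshSeries_latticePoint]
      simp only [f, hj, if_true, g]
    · intro j _ hj
      simp only [f, hj, if_false, tsum_ite_eq]
  rw [e1] at key
  convert key using 2 with k
  have hres : ∀ n : ℕ, chi (residue p (truncPoly m n * ∑ j, truncPoly m (k j) * q j)) =
      ∏ j, chi (residue p (truncPoly m (k j) * (truncPoly m n * q j))) := by
    intro n
    rw [Finset.mul_sum, residue_sum, chi_sum]
    exact Finset.prod_congr rfl fun j _ => by rw [mul_left_comm]
  rw [hres, hres, ← Finset.prod_mul_distrib]
  split_ifs with hk
  · rw [psiProd, ← Finset.prod_mul_distrib]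
    refine Finset.prod_congr rfl fun j _ => ?_
    by_cases hj : j ∈ u
    · simp only [f, hj, if_true, g]
    · simp [f, hj, supp_subset_iff.1 hk j hj, psi_zero, truncPoly_zero, residue_zero, chi_zero]
  · rw [supp_subset_iff] at hk
    push Not at hk
    obtain ⟨j, hj, hkj⟩ := hk
    rw [zero_mul, Finset.prod_eq_zero (Finset.mem_univ j)]
    simp [f, hj, hkj]

open Classical in
-- For each `k` the double sum over the points is the square of one character sum: `(2 ^ m) ^ 2` on
-- the dual lattice and 0 off it.
lemma sum_prod_walshSeries {s m : ℕ} {p : Polynomial (ZMod 2)} (hp : Irreducible p)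
    (hm : p.natDegree = m) (q : Fin s → Polynomial (ZMod 2)) (u : Finset (Fin s)) :
    (∑ n, ∑ n', ∏ j ∈ u, walshSeries fun i =>
      digitSign (Real.digits (latticePoint m p q n j) 2 i) *
        digitSign (Real.digits (latticePoint m p q n' j) 2 i)) / ((2 ^ m : ℕ) : ℝ) ^ 2 =
    ∑' k : Fin s → ℕ, if k ∈ dualLattice m p q ∧ supp k ⊆ u then psiProd k else 0 := by
  have key := (hasSum_sum fun n (_ : n ∈ Finset.univ) => hasSum_sum fun n' (_ : n' ∈ Finset.univ) =>
    hasSum_prod_walshSeries (m := m) p q u n n').div_const (((2 ^ m : ℕ) : ℝ) ^ 2)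
  rw [← key.tsum_eq]
  refine tsum_congr fun k => ?_
  simp_rw [← Finset.mul_sum]
  rw [← Finset.sum_mul, sum_chi_residue hp hm]
  have hd : k ∈ dualLattice m p q ↔ p ∣ ∑ j, truncPoly m (k j) * q j := Iff.rfl
  have h2 : ((2 : ℝ) ^ m) ≠ 0 := by positivity
  by_cases h1 : p ∣ ∑ j, truncPoly m (k j) * q j <;> by_cases h3 : supp k ⊆ u <;>
    (simp [hd, h1, h3]; try field_simp)

open Classical in
/-- The part of the dual lattice sum that belongs to the support `v`. -/
noncomputable def dualSum {s : ℕ} (m : ℕ) (p : Polynomial (ZMod 2))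
    (q : Fin s → Polynomial (ZMod 2)) (v : Finset (Fin s)) : ℝ :=
  ∑' k : Fin s → ℕ, if k ∈ dualLattice m p q ∧ supp k = v then psiProd k else 0

lemma summable_ite_psiProd {s : ℕ} (P : (Fin s → ℕ) → Prop) [DecidablePred P] :
    Summable fun k : Fin s → ℕ => if P k then psiProd k else 0 :=
  Summable.of_nonneg_of_le (fun k => by split_ifs <;> simp [(psiProd_pos k).le])
    (fun k => by split_ifs <;> simp [(psiProd_pos k).le]) (summable_psiProd s)

open Classical in
lemma tsum_supp_subset {s : ℕ} (m : ℕ) (p : Polynomial (ZMod 2))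
    (q : Fin s → Polynomial (ZMod 2)) (u : Finset (Fin s)) :
    (∑' k : Fin s → ℕ, if k ∈ dualLattice m p q ∧ supp k ⊆ u then psiProd k else 0) =
      ∑ v ∈ u.powerset, dualSum m p q v := by
  unfold dualSum
  rw [← Summable.tsum_finsetSum fun v _ => summable_ite_psiProd _]
  refine tsum_congr fun k => ?_
  by_cases hk : k ∈ dualLattice m p q
  · simp only [hk, true_and]
    rw [Finset.sum_ite_eq]
    simp [Finset.mem_powerset]
  · simp [hk]

lemma dualSum_empty {s : ℕ} (m : ℕ) (p : Polynomial (ZMod 2)) (q : Fin s → Polynomial (ZMod 2)) :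
    dualSum m p q ∅ = 1 := by
  classical
  unfold dualSum
  rw [tsum_eq_single 0]
  · rw [if_pos]
    · simp [psiProd, psi_zero]
    · refine ⟨?_, supp_eq_empty_iff.2 rfl⟩
      simp [dualLattice, truncPoly_zero]
  · intro k hk
    rw [if_neg]
    rintro ⟨-, h⟩
    exact hk (supp_eq_empty_iff.1 h)

lemma criterion_eq_sum_dualSum {s : ℕ} (γ : Finset (Fin s) → ℝ) (m : ℕ) (p : Polynomial (ZMod 2))
    (τ : ℕ) (q : Fin s → Polynomial (ZMod 2)) :
    criterion γ m p τ q = ∑ v : Finset (Fin s) with v.Nonempty ∧ ∀ j ∈ v, j.val < τ,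
      gammaTilde γ v * dualSum m p q v := by
  classical
  unfold criterion dualSum
  refine Finset.sum_congr rfl fun v _ => ?_
  congr 1
  refine (tsum_subtype {k : Fin s → ℕ | k ∈ dualLattice m p q ∧ ∀ j, k j ≠ 0 ↔ j ∈ v}
    psiProd).trans (tsum_congr fun k => ?_)
  simp only [Set.indicator_apply, Set.mem_ofPred_eq, supp_eq_iff]

/-- The mean square discrepancy of a scrambled polynomial lattice point set. -/
lemma meanSquareL2_latticePoint {s m : ℕ} {γ : Finset (Fin s) → ℝ} (hγ : ∀ u, 0 ≤ γ u)
    {p : Polynomial (ZMod 2)} (hp : Irreducible p) (hm : p.natDegree = m)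
    (q : Fin s → Polynomial (ZMod 2)) :
    meanSquareL2 γ (latticePoint m p q) = criterion γ m p s q := by
  classical
  rw [meanSquareL2_eq (by positivity) hγ, criterion_eq_sum_dualSum]
  have hfilter : ∀ v : Finset (Fin s), (v.Nonempty ∧ ∀ j ∈ v, j.val < s) ↔ v.Nonempty := fun v =>
    ⟨fun h => h.1, fun h => ⟨h, fun j _ => j.2⟩⟩
  simp only [hfilter, sum_prod_walshSeries hp hm, tsum_supp_subset, gammaTilde, Finset.sum_mul]
  -- The empty support contributes 1 and cancels the `-1`; exchanging the sums over `u` and `v` then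
  -- collects the weights into `gammaTilde`.
  have e1 : ∀ u : Finset (Fin s), ∑ v ∈ u.powerset, dualSum m p q v - 1 =
      ∑ v : Finset (Fin s), if v.Nonempty ∧ v ⊆ u then dualSum m p q v else 0 := by
    intro u
    rw [← Finset.sum_erase_add _ _ (Finset.empty_mem_powerset u), dualSum_empty, add_sub_cancel_right,
      ← Finset.sum_filter]
    refine Finset.sum_congr ?_ fun _ _ => rfl
    ext v
    simp [Finset.nonempty_iff_ne_empty]
  simp_rw [e1, Finset.mul_sum]
  rw [Finset.sum_comm, Finset.sum_filter]
  refine Finset.sum_congr rfl fun v _ => ?_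
  split_ifs with hv
  · rw [Finset.sum_filter, Finset.sum_filter]
    refine Finset.sum_congr rfl fun u _ => ?_
    by_cases hvu : v ⊆ u
    · simp [hv, hvu, hv.mono hvu]
    · simp [hvu]
  · simp [hv]

/-! ### The component-by-component bound -/

lemma rpow_tsum_le_tsum_rpow {ι : Type*} (f : ι → ℝ≥0∞) {lam : ℝ} (h0 : 0 < lam) (h1 : lam ≤ 1) :
    (∑' i, f i) ^ lam ≤ ∑' i, f i ^ lam := by
  rw [← ENNReal.le_rpow_inv_iff h0, ENNReal.tsum_eq_iSup_sum]
  refine iSup_le fun t => ?_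
  rw [ENNReal.le_rpow_inv_iff h0]
  calc (∑ i ∈ t, f i) ^ lam ≤ ∑ i ∈ t, f i ^ lam :=
        Finset.le_sum_of_subadditive (fun x : ℝ≥0∞ => x ^ lam) (by simp [h0])
          (fun x y => ENNReal.rpow_add_le_add_rpow x y h0.le h1) t f
    _ ≤ _ := ENNReal.sum_le_tsum t

/-- The power `ψ(k)^λ` as an extended nonnegative real number. -/
noncomputable def psiPow (lam : ℝ) (k : ℕ) : ℝ≥0∞ := ENNReal.ofReal (psi k) ^ lam

lemma psi_two_pow_mul (m : ℕ) {k : ℕ} (h : k ≠ 0) : psi (2 ^ m * k) = psi k / 4 ^ m := by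
  induction m with
  | zero => simp
  | succ m ih =>
    rw [show 2 ^ (m + 1) * k = 2 * (2 ^ m * k) by ring, psi_two_mul (by positivity), ih]
    field_simp; ring

/-- The factor is `2 ^ m * 4 ^ (-m * lam)`, at most 1 because `lam` exceeds one half. -/
lemma two_pow_mul_psiPow_le {lam : ℝ} (hlam : 1 / 2 < lam) (m : ℕ) {k : ℕ} (h : k ≠ 0) :
    2 ^ m * psiPow lam (2 ^ m * k) ≤ psiPow lam k := by
  have h0 : 0 ≤ lam := by linarith
  unfold psiPow
  rw [ENNReal.ofReal_rpow_of_nonneg (psi_pos _).le h0,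
    ENNReal.ofReal_rpow_of_nonneg (psi_pos _).le h0, psi_two_pow_mul m h,
    Real.div_rpow (psi_pos _).le (by positivity)]
  have h2 : (2 : ℝ) ^ m ≤ ((4 : ℝ) ^ m) ^ lam := by
    calc (2 : ℝ) ^ m = ((4 : ℝ) ^ m) ^ (1 / 2 : ℝ) := by
          rw [← Real.sqrt_eq_rpow, show (4 : ℝ) ^ m = (2 ^ m) ^ 2 by rw [← pow_mul, mul_comm, pow_mul]; norm_num,
            Real.sqrt_sq (by positivity)]
      _ ≤ _ := Real.rpow_le_rpow_of_exponent_le (one_le_pow₀ (by norm_num)) hlam.le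
  have h3 : (2 : ℝ≥0∞) ^ m = ENNReal.ofReal (2 ^ m) := by
    rw [ENNReal.ofReal_pow (by norm_num)]; norm_num
  rw [h3, ← ENNReal.ofReal_mul (by positivity)]
  refine ENNReal.ofReal_le_ofReal ?_
  have hp : 0 ≤ psi k ^ lam := Real.rpow_nonneg (psi_pos k).le _
  have h4 : 0 < ((4 : ℝ) ^ m) ^ lam := by positivity
  rw [mul_div_assoc', div_le_iff₀ h4, mul_comm]
  exact mul_le_mul_of_nonneg_left h2 hp

open Classical in
/-- Averaging over all candidates for one component. -/
lemma sum_tsum_psiPow_le {lam : ℝ} (hlam : 1 / 2 < lam) {m : ℕ} {p : Polynomial (ZMod 2)}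
    (hp : Irreducible p) (hm : p.natDegree = m) (H : Polynomial (ZMod 2)) :
    ∑ n ∈ Finset.Ico 1 (2 ^ m), ∑' a : ℕ,
        (if a ≠ 0 ∧ p ∣ truncPoly m a * truncPoly m n + H then psiPow lam a else 0) ≤
      ∑' a : ℕ, if a ≠ 0 then psiPow lam a else 0 := by
  have hnd : ∀ f : Polynomial (ZMod 2), f ≠ 0 → f.degree < (m : WithBot ℕ) → ¬ p ∣ f := by
    intro f hf hd
    refine Polynomial.not_dvd_of_degree_lt hf ?_
    rwa [Polynomial.degree_eq_natDegree hp.ne_zero, hm]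
  have hn0 : ∀ n ∈ Finset.Ico 1 (2 ^ m), truncPoly m n ≠ 0 := by
    intro n hn h0
    rw [Finset.mem_Ico] at hn
    have := Nat.le_of_dvd (by lia) (truncPoly_eq_zero_iff.1 h0)
    lia
  -- If `p ∣ H`, primality reduces the condition to `2 ^ m ∣ a` for every candidate, and
  -- `two_pow_mul_psiPow_le` absorbs their number. Otherwise `a` is invertible modulo `p` whenever
  -- the condition holds, so at most one candidate `n` satisfies it.
  by_cases hH : p ∣ H
  · have hc : ∀ n ∈ Finset.Ico 1 (2 ^ m), ∀ a,
        (p ∣ truncPoly m a * truncPoly m n + H ↔ 2 ^ m ∣ a) := by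
      intro n hn a
      rw [dvd_add_left hH, hp.prime.dvd_mul, or_iff_left (hnd _ (hn0 n hn) (degree_truncPoly_lt m n)),
        ← truncPoly_eq_zero_iff]
      refine ⟨fun h => ?_, fun h => h ▸ dvd_zero p⟩
      by_contra h0
      exact hnd _ h0 (degree_truncPoly_lt m a) h
    have e : ∀ n ∈ Finset.Ico 1 (2 ^ m), ∑' a : ℕ,
        (if a ≠ 0 ∧ p ∣ truncPoly m a * truncPoly m n + H then psiPow lam a else 0) =
        ∑' a : ℕ, if a ≠ 0 then psiPow lam (2 ^ m * a) else 0 := by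
      intro n hn
      simp_rw [hc n hn]
      rw [← (mul_right_injective₀ (pow_ne_zero m (two_ne_zero (α := ℕ)))).tsum_eq]
      · refine tsum_congr fun a => ?_
        simp
      · intro a ha
        rw [Function.mem_support] at ha
        have : a ≠ 0 ∧ 2 ^ m ∣ a := by
          by_contra h; exact ha (if_neg h)
        obtain ⟨b, hb⟩ := this.2
        exact ⟨b, hb.symm⟩
    rw [Finset.sum_congr rfl e, Finset.sum_const, Nat.card_Ico, nsmul_eq_mul]
    calc _ ≤ (2 : ℝ≥0∞) ^ m * ∑' a : ℕ, if a ≠ 0 then psiPow lam (2 ^ m * a) else 0 := by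
          gcongr
          have : ((2 ^ m - 1 : ℕ) : ℝ≥0∞) ≤ ((2 ^ m : ℕ) : ℝ≥0∞) := by
            exact_mod_cast Nat.sub_le _ _
          simp
      _ = ∑' a : ℕ, 2 ^ m * if a ≠ 0 then psiPow lam (2 ^ m * a) else 0 :=
          ENNReal.tsum_mul_left.symm
      _ ≤ _ := by
          refine ENNReal.tsum_le_tsum fun a => ?_
          split_ifs with ha
          · exact two_pow_mul_psiPow_le hlam m ha
          · simp
  · rw [← Summable.tsum_finsetSum fun _ _ => ENNReal.summable]
    refine ENNReal.tsum_le_tsum fun a => ?_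
    by_cases ha : a = 0
    · simp [ha]
    simp only [ha, ne_eq, not_false_eq_true, true_and, if_true]
    rw [← Finset.sum_filter, Finset.sum_const]
    refine (nsmul_le_nsmul_left zero_le ?_).trans (one_nsmul _).le
    rw [Finset.card_le_one]
    intro n hn n' hn'
    rw [Finset.mem_filter] at hn hn'
    have hd : p ∣ truncPoly m a * (truncPoly m n - truncPoly m n') := by
      have := dvd_sub hn.2 hn'.2
      rwa [add_sub_add_right_eq_sub, ← mul_sub] at this
    have ha0 : truncPoly m a ≠ 0 := by
      intro h0
      rw [h0, zero_mul, zero_add] at hn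
      exact hH hn.2
    rcases hp.prime.dvd_or_dvd hd with h | h
    · exact absurd h (hnd _ ha0 (degree_truncPoly_lt m a))
    · by_contra hne
      refine hnd _ (sub_ne_zero.2 fun h0 => hne ?_) ?_ h
      · exact truncPoly_injective (Finset.mem_Ico.1 hn.1).2 (Finset.mem_Ico.1 hn'.1).2 h0
      · exact (Polynomial.degree_sub_le _ _).trans_lt
          (max_lt (degree_truncPoly_lt m n) (degree_truncPoly_lt m n'))

lemma exists_tsum_eq_tsum_update {s : ℕ} (j : Fin s) :
    ∃ e : ({i // i ≠ j} → ℕ) → Fin s → ℕ, (∀ k, e k j = 0) ∧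
      ∀ F : (Fin s → ℕ) → ℝ≥0∞, ∑' k, F k = ∑' k, ∑' a : ℕ, F (Function.update (e k) j a) := by
  refine ⟨fun k => (Equiv.funSplitAt j ℕ).symm (0, k), fun k => by simp, fun F => ?_⟩
  rw [← (Equiv.funSplitAt j ℕ).symm.tsum_eq, ENNReal.tsum_prod', ENNReal.tsum_comm]
  refine tsum_congr fun k => tsum_congr fun a => congrArg F ?_
  funext i
  by_cases h : i = j
  · subst h; simp
  · simp [h]

lemma supp_update {s : ℕ} {k : Fin s → ℕ} {j : Fin s} {a : ℕ} (ha : a ≠ 0) :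
    supp (Function.update k j a) = insert j (supp k) := by
  ext i
  rw [mem_supp, Finset.mem_insert, mem_supp]
  by_cases h : i = j
  · subst h; simp [ha]
  · simp [h]

lemma psiProd_update {s : ℕ} {k : Fin s → ℕ} {j : Fin s} (hk : k j = 0) (a : ℕ) :
    psiProd (Function.update k j a) = psi a * psiProd k := by
  unfold psiProd
  rw [← Finset.mul_prod_erase _ _ (Finset.mem_univ j),
    ← Finset.mul_prod_erase Finset.univ (fun i => psi (k i)) (Finset.mem_univ j), hk, psi_zero,
    one_mul, Function.update_self]
  congr 1
  refine Finset.prod_congr rfl fun i hi => ?_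
  rw [Function.update_of_ne (Finset.ne_of_mem_erase hi)]

lemma update_mem_dualLattice {s m : ℕ} {p : Polynomial (ZMod 2)} {q : Fin s → Polynomial (ZMod 2)}
    {k : Fin s → ℕ} {j : Fin s} (hk : k j = 0) (a : ℕ) (r : Polynomial (ZMod 2)) :
    Function.update k j a ∈ dualLattice m p (Function.update q j r) ↔
      p ∣ truncPoly m a * r + ∑ i, truncPoly m (k i) * q i := by
  change p ∣ _ ↔ _
  rw [← Finset.add_sum_erase _ _ (Finset.mem_univ j),
    ← Finset.add_sum_erase Finset.univ (fun i => truncPoly m (k i) * q i) (Finset.mem_univ j), hk,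
    truncPoly_zero, zero_mul, zero_add, Function.update_self, Function.update_self]
  have : ∀ i ∈ Finset.univ.erase j, truncPoly m (Function.update k j a i) * Function.update q j r i =
      truncPoly m (k i) * q i := fun i hi => by
    rw [Function.update_of_ne (Finset.ne_of_mem_erase hi),
      Function.update_of_ne (Finset.ne_of_mem_erase hi)]
  rw [Finset.sum_congr rfl this]

lemma gammaTilde_nonneg {s : ℕ} {γ : Finset (Fin s) → ℝ} (hγ : ∀ u, 0 ≤ γ u)
    (v : Finset (Fin s)) : 0 ≤ gammaTilde γ v :=
  Finset.sum_nonneg fun u _ => div_nonneg (hγ u) (by positivity)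

/-- The contribution of the index `k` to the criterion. -/
noncomputable def weight {s : ℕ} (γ : Finset (Fin s) → ℝ) (k : Fin s → ℕ) : ℝ≥0∞ :=
  ENNReal.ofReal (gammaTilde γ (supp k) * psiProd k)

/-- The indices whose nonzero components are among the first `d` ones. -/
def initialBox (s d : ℕ) : Set (Fin s → ℕ) := {k | ∀ j ∈ supp k, j.val < d}

lemma weight_update_rpow {s : ℕ} {γ : Finset (Fin s) → ℝ} (hγ : ∀ u, 0 ≤ γ u) {lam : ℝ}
    (hlam : 0 ≤ lam) {k : Fin s → ℕ} {j : Fin s} (hk : k j = 0) {a : ℕ} (ha : a ≠ 0) :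
    weight γ (Function.update k j a) ^ lam =
      ENNReal.ofReal (gammaTilde γ (insert j (supp k)) * psiProd k) ^ lam * psiPow lam a := by
  unfold weight psiPow
  rw [supp_update ha, psiProd_update hk, ← ENNReal.mul_rpow_of_nonneg _ _ hlam,
    ← ENNReal.ofReal_mul (mul_nonneg (gammaTilde_nonneg hγ _) (psiProd_pos k).le)]
  congr 2
  ring

open Classical in
-- With the components other than `j` fixed, the weight is a constant times `psiPow lam a`, and
-- those components enter the dual condition only as a fixed polynomial `H`; `sum_tsum_psiPow_le`
-- applies.
lemma sum_tsum_weight_rpow_le {s m d : ℕ} {γ : Finset (Fin s) → ℝ} (hγ : ∀ u, 0 ≤ γ u) {lam : ℝ}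
    (hlam : 1 / 2 < lam) {p : Polynomial (ZMod 2)} (hp : Irreducible p) (hm : p.natDegree = m)
    (q : Fin s → Polynomial (ZMod 2)) (j : Fin s) :
    ∑ n ∈ Finset.Ico 1 (2 ^ m), ∑' k : Fin s → ℕ,
        (if k j ≠ 0 ∧ k ∈ initialBox s d ∧
          k ∈ dualLattice m p (Function.update q j (truncPoly m n)) then weight γ k ^ lam else 0) ≤
      ∑' k : Fin s → ℕ, if k j ≠ 0 ∧ k ∈ initialBox s d then weight γ k ^ lam else 0 := by
  obtain ⟨e, he0, he⟩ := exists_tsum_eq_tsum_update j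
  simp_rw [he]
  rw [← Summable.tsum_finsetSum fun _ _ => ENNReal.summable]
  refine ENNReal.tsum_le_tsum fun k => ?_
  set c : ℝ≥0∞ := if ∀ i ∈ insert j (supp (e k)), i.val < d then
    ENNReal.ofReal (gammaTilde γ (insert j (supp (e k))) * psiProd (e k)) ^ lam else 0 with hc
  have h1 : ∀ a, (if Function.update (e k) j a j ≠ 0 ∧ Function.update (e k) j a ∈ initialBox s d
      then weight γ (Function.update (e k) j a) ^ lam else 0) =
      c * if a ≠ 0 then psiPow lam a else 0 := by
    intro a
    rw [Function.update_self]
    by_cases ha : a = 0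
    · simp [ha]
    · rw [weight_update_rpow hγ (by linarith) (he0 k) ha]
      simp only [initialBox, Set.mem_ofPred_eq, supp_update ha, hc, ha, ne_eq, not_false_eq_true,
        true_and, if_true]
      split_ifs <;> simp
  have h2 : ∀ n a, (if Function.update (e k) j a j ≠ 0 ∧
      Function.update (e k) j a ∈ initialBox s d ∧ Function.update (e k) j a ∈
        dualLattice m p (Function.update q j (truncPoly m n))
      then weight γ (Function.update (e k) j a) ^ lam else 0) =
      c * if a ≠ 0 ∧ p ∣ truncPoly m a * truncPoly m n + ∑ i, truncPoly m (e k i) * q i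
        then psiPow lam a else 0 := by
    intro n a
    have := h1 a
    rw [update_mem_dualLattice (he0 k)]
    rw [Function.update_self] at this ⊢
    by_cases hd : p ∣ truncPoly m a * truncPoly m n + ∑ i, truncPoly m (e k i) * q i
    · simpa only [hd, and_true] using this
    · simp [hd]
  simp_rw [h1, h2, ENNReal.tsum_mul_left, ← Finset.mul_sum]
  gcongr
  exact sum_tsum_psiPow_le hlam hp hm _

open Classical in
lemma criterion_eq_tsum {s : ℕ} (γ : Finset (Fin s) → ℝ) (m : ℕ) (p : Polynomial (ZMod 2))
    (d : ℕ) (q : Fin s → Polynomial (ZMod 2)) :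
    criterion γ m p d q = ∑' k : Fin s → ℕ,
      if k ≠ 0 ∧ k ∈ initialBox s d ∧ k ∈ dualLattice m p q then
        gammaTilde γ (supp k) * psiProd k else 0 := by
  rw [criterion_eq_sum_dualSum]
  unfold dualSum
  simp_rw [← tsum_mul_left]
  rw [← Summable.tsum_finsetSum fun v _ => (summable_ite_psiProd _).mul_left _]
  refine tsum_congr fun k => ?_
  simp only [mul_ite, mul_zero]
  rw [← Finset.sum_filter, Finset.filter_filter]
  split_ifs with h
  · have : Finset.univ.filter (fun v : Finset (Fin s) => (v.Nonempty ∧ ∀ j ∈ v, j.val < d) ∧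
        k ∈ dualLattice m p q ∧ supp k = v) = {supp k} := by
      ext v
      simp only [Finset.mem_filter, Finset.mem_univ, true_and, Finset.mem_singleton]
      constructor
      · rintro ⟨-, -, h⟩; exact h.symm
      · rintro rfl
        exact ⟨⟨Finset.nonempty_iff_ne_empty.2 (supp_eq_empty_iff.not.2 h.1), h.2.1⟩, h.2.2, rfl⟩
    rw [this, Finset.sum_singleton]
  · refine Finset.sum_eq_zero fun v hv => absurd ?_ h
    simp only [Finset.mem_filter, Finset.mem_univ, true_and] at hv
    obtain ⟨⟨h1, h2⟩, h3, rfl⟩ := hv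
    exact ⟨supp_eq_empty_iff.not.1 h1.ne_empty, h2, h3⟩

open Classical in
lemma ofReal_criterion {s : ℕ} {γ : Finset (Fin s) → ℝ} (hγ : ∀ u, 0 ≤ γ u) (m : ℕ)
    (p : Polynomial (ZMod 2)) (d : ℕ) (q : Fin s → Polynomial (ZMod 2)) :
    ENNReal.ofReal (criterion γ m p d q) = ∑' k : Fin s → ℕ,
      if k ≠ 0 ∧ k ∈ initialBox s d ∧ k ∈ dualLattice m p q then weight γ k else 0 := by
  have hnn : ∀ k : Fin s → ℕ, 0 ≤ gammaTilde γ (supp k) * psiProd k := fun k =>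
    mul_nonneg (gammaTilde_nonneg hγ _) (psiProd_pos k).le
  rw [criterion_eq_tsum, ENNReal.ofReal_tsum_of_nonneg]
  · refine tsum_congr fun k => ?_
    split_ifs <;> simp [weight]
  · intro k
    split_ifs
    · exact hnn k
    · exact le_rfl
  · refine Summable.of_nonneg_of_le (fun k => ?_) (fun k => ?_)
      ((summable_psiProd s).mul_left (∑ v, gammaTilde γ v))
    · split_ifs
      · exact hnn k
      · exact le_rfl
    · have h1 : gammaTilde γ (supp k) * psiProd k ≤ (∑ v, gammaTilde γ v) * psiProd k :=
        mul_le_mul_of_nonneg_right (Finset.single_le_sum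
          (fun v _ => gammaTilde_nonneg hγ v) (Finset.mem_univ _)) (psiProd_pos k).le
      split_ifs
      · exact h1
      · exact (hnn k).trans h1

lemma initialBox_succ {s : ℕ} {j : Fin s} {k : Fin s → ℕ} :
    k ∈ initialBox s j.val ↔ k j = 0 ∧ k ∈ initialBox s (j.val + 1) := by
  simp only [initialBox, Set.mem_ofPred_eq, mem_supp]
  constructor
  · intro h
    refine ⟨?_, fun i hi => (h i hi).trans (Nat.lt_succ_self _)⟩
    by_contra hj
    exact lt_irrefl _ (h j hj)
  · rintro ⟨h0, h⟩ i hi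
    refine lt_of_le_of_ne (Nat.lt_succ_iff.1 (h i hi)) fun hij => hi ?_
    rw [Fin.ext hij, h0]

lemma update_mem_dualLattice_iff {s m : ℕ} {p : Polynomial (ZMod 2)}
    {q : Fin s → Polynomial (ZMod 2)} {k : Fin s → ℕ} {j : Fin s} (hk : k j = 0)
    (r : Polynomial (ZMod 2)) :
    k ∈ dualLattice m p (Function.update q j r) ↔ k ∈ dualLattice m p q := by
  have := update_mem_dualLattice (q := q) (m := m) (p := p) hk 0 r
  rw [← hk, Function.update_eq_self, hk, truncPoly_zero, zero_mul, zero_add] at this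
  exact this

open Classical in
/-- The contribution to the criterion of the indices whose last nonzero component is `j`. -/
noncomputable def lastPart {s : ℕ} (γ : Finset (Fin s) → ℝ) (m : ℕ) (p : Polynomial (ZMod 2))
    (q : Fin s → Polynomial (ZMod 2)) (j : Fin s) (r : Polynomial (ZMod 2)) : ℝ≥0∞ :=
  ∑' k : Fin s → ℕ, if k j ≠ 0 ∧ k ∈ initialBox s (j.val + 1) ∧
    k ∈ dualLattice m p (Function.update q j r) then weight γ k else 0

lemma tsum_ite_succ {s : ℕ} (j : Fin s) (P : (Fin s → ℕ) → Prop) (f : (Fin s → ℕ) → ℝ≥0∞)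
    [DecidablePred fun k : Fin s → ℕ => k ≠ 0 ∧ k ∈ initialBox s (j.val + 1) ∧ P k]
    [DecidablePred fun k : Fin s → ℕ => k ≠ 0 ∧ k ∈ initialBox s j.val ∧ P k]
    [DecidablePred fun k : Fin s → ℕ => k j ≠ 0 ∧ k ∈ initialBox s (j.val + 1) ∧ P k] :
    (∑' k : Fin s → ℕ, if k ≠ 0 ∧ k ∈ initialBox s (j.val + 1) ∧ P k then f k else 0) =
      (∑' k : Fin s → ℕ, if k ≠ 0 ∧ k ∈ initialBox s j.val ∧ P k then f k else 0) +
      ∑' k : Fin s → ℕ, if k j ≠ 0 ∧ k ∈ initialBox s (j.val + 1) ∧ P k then f k else 0 := by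
  rw [← ENNReal.tsum_add]
  refine tsum_congr fun k => ?_
  by_cases hj : k j = 0
  · simp [initialBox_succ, hj]
  · have : k ≠ 0 := fun h => hj (by rw [h]; rfl)
    simp only [initialBox_succ, hj, false_and, and_false, if_false, zero_add]
    exact if_congr (by simp [hj, this]) rfl rfl

/-- Indices with `k j = 0` do not see the `j`-th generator, so they reproduce the previous criterion
for any `r`. -/
lemma ofReal_criterion_succ {s : ℕ} {γ : Finset (Fin s) → ℝ} (hγ : ∀ u, 0 ≤ γ u) (m : ℕ)
    (p : Polynomial (ZMod 2)) (q : Fin s → Polynomial (ZMod 2)) (j : Fin s)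
    (r : Polynomial (ZMod 2)) :
    ENNReal.ofReal (criterion γ m p (j.val + 1) (Function.update q j r)) =
      ENNReal.ofReal (criterion γ m p j.val q) + lastPart γ m p q j r := by
  classical
  rw [ofReal_criterion hγ, ofReal_criterion hγ,
    tsum_ite_succ j (fun k => k ∈ dualLattice m p (Function.update q j r)), lastPart]
  congr 1
  refine tsum_congr fun k => ?_
  by_cases hk : k ∈ initialBox s j.val
  · rw [update_mem_dualLattice_iff (initialBox_succ.1 hk).1]
  · simp [hk]

lemma IsCBC.lastPart_le {s m : ℕ} {γ : Finset (Fin s) → ℝ} (hγ : ∀ u, 0 ≤ γ u)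
    {p : Polynomial (ZMod 2)} {q : Fin s → Polynomial (ZMod 2)} (h : IsCBC γ m p q) (j : Fin s)
    {r : Polynomial (ZMod 2)} (hr : r ∈ candidates m) :
    lastPart γ m p q j (q j) ≤ lastPart γ m p q j r := by
  -- The first component is fixed rather than minimised, but 1 is optimal anyway: for indices
  -- supported on it, `p ∣ k` implies `p ∣ k * r`. For later components the common finite summand is
  -- cancelled.
  rcases Nat.eq_zero_or_pos j.val with hj | hj
  · classical
    unfold lastPart
    refine ENNReal.tsum_le_tsum fun k => ?_
    rw [h.first j hj]
    by_cases hk : k j ≠ 0 ∧ k ∈ initialBox s (j.val + 1)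
    · have hi : ∀ i, i ≠ j → k i = 0 := fun i hij => by
        by_contra hki
        have := hk.2 i (mem_supp.2 hki)
        exact hij (Fin.ext (by lia))
      have hd : ∀ r, k ∈ dualLattice m p (Function.update q j r) ↔ p ∣ truncPoly m (k j) * r := by
        intro r
        change p ∣ _ ↔ _
        rw [Finset.sum_eq_single j]
        · rw [Function.update_self]
        · intro i _ hij; rw [hi i hij, truncPoly_zero, zero_mul]
        · simp
      rw [hd, hd, mul_one]
      by_cases h1 : p ∣ truncPoly m (k j)
      · simp [h1, h1.mul_right r]
      · simp [h1]
    · rw [if_neg (by tauto)]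
      exact zero_le
  · have h1 := ENNReal.ofReal_le_ofReal (h.minimal j hj r hr)
    have h2 := ofReal_criterion_succ hγ m p q j (q j)
    rw [Function.update_eq_self] at h2
    rw [h2, ofReal_criterion_succ hγ] at h1
    exact (ENNReal.add_le_add_iff_left ENNReal.ofReal_ne_top).1 h1

lemma truncPoly_mem_candidates {m n : ℕ} (hn : n ∈ Finset.Ico 1 (2 ^ m)) :
    truncPoly m n ∈ candidates m := by
  refine ⟨fun h0 => ?_, degree_truncPoly_lt m n⟩
  rw [Finset.mem_Ico] at hn
  have := Nat.le_of_dvd (by lia) (truncPoly_eq_zero_iff.1 h0)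
  lia

open Classical in
-- The minimum is at most each candidate's value; the power passes inside the sum because `lam ≤ 1`.
lemma IsCBC.mul_lastPart_rpow_le {s m : ℕ} {γ : Finset (Fin s) → ℝ} (hγ : ∀ u, 0 ≤ γ u)
    {lam : ℝ} (hlam : 1 / 2 < lam) (hlam' : lam ≤ 1) {p : Polynomial (ZMod 2)}
    {q : Fin s → Polynomial (ZMod 2)} (h : IsCBC γ m p q) (j : Fin s) :
    ((2 ^ m - 1 : ℕ) : ℝ≥0∞) * lastPart γ m p q j (q j) ^ lam ≤
      ∑' k : Fin s → ℕ, if k j ≠ 0 ∧ k ∈ initialBox s (j.val + 1) then weight γ k ^ lam else 0 := by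
  have h0 : 0 < lam := by linarith
  calc ((2 ^ m - 1 : ℕ) : ℝ≥0∞) * lastPart γ m p q j (q j) ^ lam
      = ∑ n ∈ Finset.Ico 1 (2 ^ m), lastPart γ m p q j (q j) ^ lam := by
        rw [Finset.sum_const, Nat.card_Ico, nsmul_eq_mul]
    _ ≤ ∑ n ∈ Finset.Ico 1 (2 ^ m), lastPart γ m p q j (truncPoly m n) ^ lam :=
        Finset.sum_le_sum fun n hn => ENNReal.rpow_le_rpow
          (h.lastPart_le hγ j (truncPoly_mem_candidates hn)) h0.le
    _ ≤ ∑ n ∈ Finset.Ico 1 (2 ^ m), ∑' k : Fin s → ℕ,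
        (if k j ≠ 0 ∧ k ∈ initialBox s (j.val + 1) ∧
          k ∈ dualLattice m p (Function.update q j (truncPoly m n)) then weight γ k ^ lam else 0) := by
        refine Finset.sum_le_sum fun n _ => (rpow_tsum_le_tsum_rpow _ h0 hlam').trans_eq ?_
        refine tsum_congr fun k => ?_
        split_ifs <;> simp [h0]
    _ ≤ _ := sum_tsum_weight_rpow_le hγ hlam h.irreducible h.natDegree_eq q j

open Classical in
lemma IsCBC.mul_criterion_rpow_le {s m : ℕ} {γ : Finset (Fin s) → ℝ} (hγ : ∀ u, 0 ≤ γ u)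
    {lam : ℝ} (hlam : 1 / 2 < lam) (hlam' : lam ≤ 1) {p : Polynomial (ZMod 2)}
    {q : Fin s → Polynomial (ZMod 2)} (h : IsCBC γ m p q) {d : ℕ} (hd : d ≤ s) :
    ((2 ^ m - 1 : ℕ) : ℝ≥0∞) * ENNReal.ofReal (criterion γ m p d q) ^ lam ≤
      ∑' k : Fin s → ℕ, if k ≠ 0 ∧ k ∈ initialBox s d then weight γ k ^ lam else 0 := by
  have h0 : 0 < lam := by linarith
  induction d with
  | zero =>
    have : criterion γ m p 0 q = 0 := by
      unfold criterion
      rw [Finset.filter_false_of_mem, Finset.sum_empty]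
      rintro v - ⟨⟨j, hj⟩, h⟩
      exact absurd (h j hj) (Nat.not_lt_zero _)
    simp [this, h0]
  | succ d ih =>
    let j : Fin s := ⟨d, hd⟩
    have e := ofReal_criterion_succ hγ m p q j (q j)
    rw [Function.update_eq_self] at e
    have e2 := tsum_ite_succ j (fun _ => True) fun k => weight γ k ^ lam
    simp only [and_true] at e2
    change _ * ENNReal.ofReal (criterion γ m p (j.val + 1) q) ^ lam ≤
      ∑' k : Fin s → ℕ, if k ≠ 0 ∧ k ∈ initialBox s (j.val + 1) then weight γ k ^ lam else 0
    rw [e, e2]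
    calc _ ≤ ((2 ^ m - 1 : ℕ) : ℝ≥0∞) * (ENNReal.ofReal (criterion γ m p j.val q) ^ lam +
          lastPart γ m p q j (q j) ^ lam) := by
          gcongr
          exact ENNReal.rpow_add_le_add_rpow _ _ h0.le hlam'
      _ ≤ _ := by
          rw [mul_add]
          exact add_le_add (ih (by lia)) (h.mul_lastPart_rpow_le hγ hlam hlam' j)

/-! ### The sum over all indices -/

lemma psiProd_rpow {s : ℕ} (k : Fin s → ℕ) (lam : ℝ) :
    psiProd k ^ lam = ∏ j, psi (k j) ^ lam :=
  (Real.finsetProd_rpow _ _ (fun _ _ => (psi_pos _).le) _).symm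

open Classical in
-- The sum over all vectors supported in `u` factors into one-dimensional sums; the `-1` removes `k
-- = 0`.
lemma hasSum_psiProd_rpow {s : ℕ} {lam : ℝ} (hlam : 1 / 2 < lam) (u : Finset (Fin s)) :
    HasSum (fun k : Fin s → ℕ => if k ≠ 0 ∧ supp k ⊆ u then psiProd k ^ lam else 0)
      (-1 + (((2 : ℝ) ^ (2 * lam) - 1) / ((2 : ℝ) ^ (2 * lam) - 2)) ^ u.card) := by
  let f : Fin s → ℕ → ℝ := fun j k => if j ∈ u then psi k ^ lam else if k = 0 then 1 else 0
  have hf : ∀ j, Summable fun k => ‖f j k‖ := fun j => by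
    by_cases hj : j ∈ u
    · simpa only [f, hj, if_true] using (summable_psi_rpow hlam).norm
    · simp only [f, hj, if_false]
      exact (hasSum_ite_eq 0 (1 : ℝ)).summable.norm
  have key := (hasSum_pi_prod f hf).2
  have e1 : ∏ j, ∑' k, f j k =
      (((2 : ℝ) ^ (2 * lam) - 1) / ((2 : ℝ) ^ (2 * lam) - 2)) ^ u.card := by
    rw [← Finset.prod_const, ← Finset.prod_subset (Finset.subset_univ u)]
    · refine Finset.prod_congr rfl fun j hj => ?_
      simp only [f, hj, if_true, tsum_psi_rpow hlam]
    · intro j _ hj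
      simp only [f, hj, if_false, tsum_ite_eq]
  rw [e1] at key
  have h0 : HasSum (fun k : Fin s → ℕ => if k = 0 then (-1 : ℝ) else 0) (-1) := hasSum_ite_eq 0 _
  convert h0.add key using 2 with k
  by_cases hk : supp k ⊆ u
  · have : ∏ j, f j (k j) = psiProd k ^ lam := by
      rw [psiProd_rpow]
      refine Finset.prod_congr rfl fun j _ => ?_
      by_cases hj : j ∈ u
      · simp only [f, hj, if_true]
      · simp [f, hj, supp_subset_iff.1 hk j hj, psi_zero]
    rw [this]
    by_cases hk0 : k = 0
    · subst hk0; simp [psiProd, psi_zero]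
    · simp [hk0, hk]
  · have h1 : k ≠ 0 := by
      rintro rfl
      exact hk (by rw [supp_eq_empty_iff.2 rfl]; exact Finset.empty_subset u)
    have h2 : ∏ j, f j (k j) = 0 := by
      rw [supp_subset_iff] at hk
      push Not at hk
      obtain ⟨j, hj, hkj⟩ := hk
      exact Finset.prod_eq_zero (Finset.mem_univ j) (by simp [f, hj, hkj])
    simp [hk, h1, h2]

/-- The sum in the numerator of the weight ratio. -/
noncomputable def weightSum {s : ℕ} (γ : Finset (Fin s) → ℝ) (lam : ℝ) : ℝ :=
  ∑ u : Finset (Fin s) with u.Nonempty, (γ u / 3 ^ u.card) ^ lam *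
    (-1 + (((2 : ℝ) ^ (2 * lam) - 1) / ((2 : ℝ) ^ (2 * lam) - 2)) ^ u.card)

lemma weightSum_term_nonneg {s : ℕ} {γ : Finset (Fin s) → ℝ} (hγ : ∀ u, 0 ≤ γ u) {lam : ℝ}
    (hlam : 1 / 2 < lam) (u : Finset (Fin s)) : 0 ≤ (γ u / 3 ^ u.card) ^ lam *
      (-1 + (((2 : ℝ) ^ (2 * lam) - 1) / ((2 : ℝ) ^ (2 * lam) - 2)) ^ u.card) := by
  classical
  refine mul_nonneg (Real.rpow_nonneg (div_nonneg (hγ u) (by positivity)) _)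
    ((hasSum_psiProd_rpow hlam u).nonneg fun k => ?_)
  split_ifs
  · exact Real.rpow_nonneg (psiProd_pos k).le _
  · exact le_rfl

lemma weightSum_nonneg {s : ℕ} {γ : Finset (Fin s) → ℝ} (hγ : ∀ u, 0 ≤ γ u) {lam : ℝ}
    (hlam : 1 / 2 < lam) : 0 ≤ weightSum γ lam :=
  Finset.sum_nonneg fun u _ => weightSum_term_nonneg hγ hlam u

open Classical in
-- Subadditivity once more, now for the sum over `u` inside `gammaTilde`.
lemma weight_rpow_le {s : ℕ} {γ : Finset (Fin s) → ℝ} (hγ : ∀ u, 0 ≤ γ u) {lam : ℝ}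
    (h0 : 0 < lam) (h1 : lam ≤ 1) (k : Fin s → ℕ) :
    weight γ k ^ lam ≤ ∑ u : Finset (Fin s), ENNReal.ofReal ((γ u / 3 ^ u.card) ^ lam) *
      if supp k ⊆ u then ENNReal.ofReal (psiProd k ^ lam) else 0 := by
  have hc : ∀ u : Finset (Fin s), 0 ≤ γ u / 3 ^ u.card := fun u => div_nonneg (hγ u) (by positivity)
  have hg : ENNReal.ofReal (gammaTilde γ (supp k)) ^ lam ≤
      ∑ u : Finset (Fin s) with supp k ⊆ u, ENNReal.ofReal ((γ u / 3 ^ u.card) ^ lam) := by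
    unfold gammaTilde
    rw [ENNReal.ofReal_sum_of_nonneg fun u _ => hc u]
    refine (Finset.le_sum_of_subadditive (fun x : ℝ≥0∞ => x ^ lam) (by simp [h0])
      (fun x y => ENNReal.rpow_add_le_add_rpow x y h0.le h1) _ _).trans_eq ?_
    refine Finset.sum_congr ?_ fun u _ => ENNReal.ofReal_rpow_of_nonneg (hc u) h0.le
    congr
  unfold weight
  rw [ENNReal.ofReal_mul (gammaTilde_nonneg hγ _), ENNReal.mul_rpow_of_nonneg _ _ h0.le,
    ENNReal.ofReal_rpow_of_nonneg (psiProd_pos k).le h0.le]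
  refine (mul_le_mul_left hg _).trans_eq ?_
  rw [Finset.sum_mul, Finset.sum_filter]
  exact Finset.sum_congr rfl fun u _ => by split_ifs <;> simp

open Classical in
lemma tsum_weight_rpow_le {s : ℕ} {γ : Finset (Fin s) → ℝ} (hγ : ∀ u, 0 ≤ γ u) {lam : ℝ}
    (hlam : 1 / 2 < lam) (hlam' : lam ≤ 1) :
    (∑' k : Fin s → ℕ, if k ≠ 0 ∧ k ∈ initialBox s s then weight γ k ^ lam else 0) ≤
      ENNReal.ofReal (weightSum γ lam) := by
  have h0 : 0 < lam := by linarith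
  have hs : ∀ u : Finset (Fin s), ∑' k : Fin s → ℕ,
      ENNReal.ofReal (if k ≠ 0 ∧ supp k ⊆ u then psiProd k ^ lam else 0) = ENNReal.ofReal
        (-1 + (((2 : ℝ) ^ (2 * lam) - 1) / ((2 : ℝ) ^ (2 * lam) - 2)) ^ u.card) := by
    intro u
    have h := hasSum_psiProd_rpow hlam u
    rw [← h.tsum_eq, ENNReal.ofReal_tsum_of_nonneg (fun k => ?_) h.summable]
    split_ifs
    · exact Real.rpow_nonneg (psiProd_pos k).le _
    · exact le_rfl
  calc _ ≤ ∑' k : Fin s → ℕ, ∑ u : Finset (Fin s), ENNReal.ofReal ((γ u / 3 ^ u.card) ^ lam) *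
        ENNReal.ofReal (if k ≠ 0 ∧ supp k ⊆ u then psiProd k ^ lam else 0) := by
        refine ENNReal.tsum_le_tsum fun k => ?_
        split_ifs with hk
        · refine (weight_rpow_le hγ h0 hlam' k).trans_eq (Finset.sum_congr rfl fun u _ => ?_)
          by_cases hu : supp k ⊆ u <;> simp [hk.1, hu]
        · exact zero_le
    _ = ∑ u : Finset (Fin s), ENNReal.ofReal ((γ u / 3 ^ u.card) ^ lam *
        (-1 + (((2 : ℝ) ^ (2 * lam) - 1) / ((2 : ℝ) ^ (2 * lam) - 2)) ^ u.card)) := by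
        rw [Summable.tsum_finsetSum fun _ _ => ENNReal.summable]
        refine Finset.sum_congr rfl fun u _ => ?_
        rw [ENNReal.tsum_mul_left, hs, ENNReal.ofReal_mul
          (Real.rpow_nonneg (div_nonneg (hγ u) (by positivity)) _)]
    _ = _ := by
        rw [weightSum, ENNReal.ofReal_sum_of_nonneg fun u _ => weightSum_term_nonneg hγ hlam u]
        refine (Finset.sum_subset (Finset.filter_subset _ _) fun u _ hu => ?_).symm
        have : u = ∅ := by simpa [Finset.not_nonempty_iff_eq_empty] using hu
        simp [this]

/-- The error bound for the component-by-component construction. -/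
lemma IsCBC.two_pow_mul_criterion_rpow_le {s m : ℕ} (hm : 1 ≤ m) {γ : Finset (Fin s) → ℝ}
    (hγ : ∀ u, 0 ≤ γ u) {lam : ℝ} (hlam : 1 / 2 < lam) (hlam' : lam ≤ 1)
    {p : Polynomial (ZMod 2)} {q : Fin s → Polynomial (ZMod 2)} (h : IsCBC γ m p q)
    (h0 : 0 ≤ criterion γ m p s q) :
    2 ^ (m - 1) * criterion γ m p s q ^ lam ≤ weightSum γ lam := by
  classical
  have h1 := (h.mul_criterion_rpow_le hγ hlam hlam' le_rfl).trans
    (tsum_weight_rpow_le hγ hlam hlam')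
  rw [ENNReal.ofReal_rpow_of_nonneg h0 (by linarith), ← ENNReal.ofReal_natCast,
    ← ENNReal.ofReal_mul (by positivity), ENNReal.ofReal_le_ofReal_iff (weightSum_nonneg hγ hlam)] at h1
  refine le_trans ?_ h1
  gcongr
  have h2 : 2 ^ (m - 1) ≤ 2 ^ m - 1 := by
    obtain ⟨l, rfl⟩ := Nat.exists_eq_add_of_le' hm
    have := Nat.one_le_two_pow (n := l)
    rw [Nat.add_sub_cancel, pow_succ]
    lia
  exact_mod_cast h2

/-! ### From the error bound to tractability. -/

lemma weightSum_le {s : ℕ} {γ : Finset (Fin s) → ℝ} (hγ : ∀ u, 0 ≤ γ u) {lam : ℝ}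
    (hlam : 1 / 2 < lam) {B : ℝ} (hB : weightRatio γ lam ≤ B) :
    weightSum γ lam ≤ (B * initialMeanSquareL2 γ) ^ lam := by
  have h0 : 0 < lam := by linarith
  rw [initialMeanSquareL2_eq hγ]
  have hc : ∀ u : Finset (Fin s), 0 ≤ γ u / 3 ^ u.card := fun u => div_nonneg (hγ u) (by positivity)
  set I := ∑ u : Finset (Fin s) with u.Nonempty, γ u / 3 ^ u.card with hI
  -- For `I = 0` the ratio is 0 by convention and carries no information; but then all relevant
  -- weights vanish.
  rcases (Finset.sum_nonneg fun u _ => hc u : 0 ≤ I).eq_or_lt with h | h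
  · have hz := (Finset.sum_eq_zero_iff_of_nonneg fun u _ => hc u).1 (hI.symm.trans h.symm)
    rw [show I = 0 from h.symm, mul_zero, Real.zero_rpow h0.ne', weightSum]
    refine (Finset.sum_eq_zero fun u hu => ?_).le
    rw [hz u hu, Real.zero_rpow h0.ne', zero_mul]
  · have h1 : weightSum γ lam ^ (1 / lam) ≤ B * I := (div_le_iff₀ h).1 hB
    calc weightSum γ lam = (weightSum γ lam ^ (1 / lam)) ^ lam := by
          rw [← Real.rpow_mul (weightSum_nonneg hγ hlam), one_div_mul_cancel h0.ne', Real.rpow_one]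
      _ ≤ _ := Real.rpow_le_rpow (Real.rpow_nonneg (weightSum_nonneg hγ hlam) _) h1 h0.le

lemma meanSquareL2_nonneg {N s : ℕ} (γ : Finset (Fin s) → ℝ) (x : Fin N → Fin s → ℝ) :
    0 ≤ meanSquareL2 γ x :=
  integral_nonneg fun _ => sq_nonneg _

lemma IsCBC.meanSquareL2_le {s m : ℕ} (hm : 1 ≤ m) {γ : Finset (Fin s) → ℝ} (hγ : ∀ u, 0 ≤ γ u)
    {lam : ℝ} (hlam : 1 / 2 < lam) (hlam' : lam ≤ 1) {p : Polynomial (ZMod 2)}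
    {q : Fin s → Polynomial (ZMod 2)} (h : IsCBC γ m p q) {B : ℝ} (hB0 : 0 ≤ B)
    (hB : weightRatio γ lam ≤ B) {ε : ℝ} (hε : 0 < ε) (hmε : B ^ lam * ε ^ (-lam) ≤ 2 ^ (m - 1)) :
    meanSquareL2 γ (latticePoint m p q) ≤ ε * initialMeanSquareL2 γ := by
  have h0 : 0 < lam := by linarith
  have hI : 0 ≤ initialMeanSquareL2 γ := meanSquareL2_nonneg _ _
  have hE := meanSquareL2_nonneg γ (latticePoint m p q)
  have h1 : 2 ^ (m - 1) * meanSquareL2 γ (latticePoint m p q) ^ lam ≤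
      (B * initialMeanSquareL2 γ) ^ lam := by
    rw [meanSquareL2_latticePoint hγ h.irreducible h.natDegree_eq] at hE ⊢
    exact (h.two_pow_mul_criterion_rpow_le hm hγ hlam hlam' hE).trans (weightSum_le hγ hlam hB)
  by_contra! hlt
  have h2 := Real.rpow_lt_rpow (mul_nonneg hε.le hI) hlt h0
  have h3 : (B * initialMeanSquareL2 γ) ^ lam ≤ 2 ^ (m - 1) * (ε * initialMeanSquareL2 γ) ^ lam := by
    rw [Real.mul_rpow hB0 hI, Real.mul_rpow hε.le hI, ← mul_assoc]
    refine mul_le_mul_of_nonneg_right ?_ (Real.rpow_nonneg hI _)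
    rwa [Real.rpow_neg hε.le, ← div_eq_mul_inv, div_le_iff₀ (Real.rpow_pos_of_pos hε _)] at hmε
  have h4 := mul_lt_mul_of_pos_left h2 (show (0 : ℝ) < 2 ^ (m - 1) by positivity)
  linarith

lemma stronglyTractable_of_weightConst_lt_top {γ : (s : ℕ) → Finset (Fin s) → ℝ}
    (hγ : ∀ s u, 0 ≤ γ s u) {lam : ℝ} (hlam : 1 / 2 < lam) (hlam' : lam ≤ 1)
    (hB : weightConst γ lam < ⊤) : StronglyTractable γ lam := by
  obtain ⟨b, hb, -⟩ := EReal.lt_iff_exists_real_btwn.1 hB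
  have h0 : 0 ≤ lam := by linarith
  -- The truncation at 0 keeps the real powers of the bound well behaved.
  set B : ℝ := max b 0 with hBdef
  have hB0 : 0 ≤ B := le_max_right _ _
  have hratio : ∀ s, 1 ≤ s → weightRatio (γ s) lam ≤ B := fun s hs => by
    have h1 : (weightRatio (γ s) lam : EReal) ≤ weightConst γ lam :=
      le_iSup₂ (f := fun (s : ℕ) (_ : 1 ≤ s) => (weightRatio (γ s) lam : EReal)) s hs
    exact (EReal.coe_le_coe_iff.1 (h1.trans hb.le)).trans (le_max_left _ _)
  -- The 2 covers a least exponent `m = 1`. If the least `m` is larger, then `m - 1` fails, so `2 ^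
  -- (m - 2) < K` and `2 ^ m < 4 * K`.
  refine ⟨h0, 2 + 4 * B ^ lam, by positivity, fun s hs p q hcbc ε hε hε1 => ?_⟩
  set K : ℝ := B ^ lam * ε ^ (-lam) with hK
  have hgood : ∀ m, 1 ≤ m → K ≤ 2 ^ (m - 1) →
      meanSquareL2 (γ s) (latticePoint m (p m) (q m)) ≤ ε * initialMeanSquareL2 (γ s) :=
    fun m hm hKm => (hcbc m hm).meanSquareL2_le hm (hγ s) hlam hlam' hB0 (hratio s hs) hε hKm
  classical
  have hex : ∃ m, 1 ≤ m ∧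
      meanSquareL2 (γ s) (latticePoint m (p m) (q m)) ≤ ε * initialMeanSquareL2 (γ s) := by
    obtain ⟨n, hn⟩ := pow_unbounded_of_one_lt K (one_lt_two : (1 : ℝ) < 2)
    exact ⟨n + 1, by lia, hgood (n + 1) (by lia) (by simpa using hn.le)⟩
  have hspec := Nat.find_spec hex
  refine ⟨2 ^ Nat.find hex, ⟨⟨Nat.find hex, hspec.1, rfl, hspec.2⟩, ?_⟩, ?_⟩
  · rintro N ⟨m, hm, rfl, hle⟩
    exact Nat.pow_le_pow_right (by norm_num) (Nat.find_min' hex ⟨hm, hle⟩)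
  · have hε' : 1 ≤ ε ^ (-lam) := Real.one_le_rpow_of_pos_of_le_one_of_nonpos hε hε1.le (by linarith)
    have hK0 : 0 ≤ K := by positivity
    have hC : (2 + 4 * B ^ lam) * ε ^ (-lam) = 2 * ε ^ (-lam) + 4 * K := by rw [hK]; ring
    rw [hC]
    push_cast
    rcases hspec.1.eq_or_lt with h1 | h1
    · rw [← h1]; linarith
    · have hmin := Nat.find_min hex (Nat.sub_lt hspec.1 one_pos)
      have hlt : 2 ^ (Nat.find hex - 1 - 1) < K := by
        by_contra! hKm
        exact hmin ⟨by lia, hgood _ (by lia) hKm⟩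
      have h2 : (2 : ℝ) ^ Nat.find hex = 4 * 2 ^ (Nat.find hex - 1 - 1) := by
        rw [show (4 : ℝ) = 2 ^ 2 by norm_num, ← pow_add]
        congr 1
        lia
      rw [h2]
      linarith

end PolyLattice

/-- Strong tractability of the mean square weighted `L₂` discrepancy of CBC-constructed scrambled
polynomial lattice rules, with exponent of tractability at most `λ`. -/
theorem mainTheorem4 (γ : (s : ℕ) → Finset (Fin s) → ℝ) (hγ : ∀ s u, 0 ≤ γ s u)
    (lam : ℝ) (hlam : 1 / 2 < lam) (hlam' : lam ≤ 1)
    (hB : PolyLattice.weightConst γ lam < ⊤) :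
    PolyLattice.StronglyTractable γ lam :=
  PolyLattice.stronglyTractable_of_weightConst_lt_top hγ hlam hlam' hB
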